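/- Maximum asymptotic spatial smoothing gain for a single source. Setting. Let $R\ge 1$ and consider a uniform $R$-dimensional array with $M_p\ge 1$ sensors in mode $p$, $M=\prod_{p=1}^R M_p$, and fix a mode $r$ with $M_r\ge 2$. One source with spatial frequencies $\mu^{(1)},\dots,\mu^{(R)}$ and symbols $s\in\mathbb C^N\setminus\{0\}$ is observed as $X=a(\mu)\,s^{T}+W\in\mathbb C^{M\times N}$, where $a(\mu)$ is the Kronecker product of the mode-wise steering vectors $\big(e^{\mathrm j (m-(M_p-1)/2+\delta_p)\mu^{(p)}}\big)_{0\le m<M_p}$ ($\delta_p\in\mathbb R$ is an arbitrary phase reference) and $W$ is zero-mean circularly symmetric white noise of variance $\sigma^2>0$ (finite second moments, $\mathbb E[W_{in}\overline{W_{jk}}]=\sigma^2$ if $(i,n)=(j,k)$ and $0$ otherwise, $\mathbb E[W_{in}W_{jk}]=0$). Let $\hat\rho=\|s\|_2^2/\sigma^2$ be the effective SNR. Spatial smoothing with $L_p$ subarrays in mode $p$ replaces $X$ by the matrix formed of all data blocks of the $\prod_p L_p$ maximally overlapping subarrays with $M_p-L_p+1$ sensors in mode $p$. The algorithm is any of $R$-D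 Standard ESPRIT, $R$-D Unitary ESPRIT (asymptotically: forward-backward averaging (FBA), $Y\mapsto[Y,\ \Pi Y^{*}\Pi]$, of the smoothed data), $R$-D NC Standard ESPRIT (data augmented to $[X;\Pi X^{*}]$ before smoothing) and $R$-D NC Unitary ESPRIT (both); for the NC algorithms the source is strictly non-circular, $s=e^{\mathrm j\varphi}s_0$ with $\varphi\in\mathbb R$, $s_0\in\mathbb R^N$. Here $\Pi$ denotes exchange matrices and $^*$ entrywise conjugation. The asymptotic mean squared error is $\mathrm{MSE}^{(r)}_{\rm SS}=\mathbb E\{(\Delta\mu^{(r)})^2\}$, where $\Delta\mu^{(r)}$ is the first-order error of the least squares solution: if $X_0=\sigma_1 u v^{H}$ is the compact SVD of the preprocessed noise-free data, $E$ the preprocessed noise, and $J_1,J_2$ select the first and the last $M_r-L_r$ elements of the subarray in mode $r$ (in each of the two halves of the rows for the NC algorithms), then $$\Delta\mu^{(r)}=\mathrm{Im}\Big\{(J_1u)^{+}\big(e^{-\mathrm j\mu^{(r)}}J_2-J_1\big)(I-uu^{H})E\,v\,\sigma_1^{-1}\Big\}.$$ $\mathrm{MSE}^{(r)}$ denotes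 the case without smoothing ($L_p=1$ for all $p$). Statement. Fix $L_p\in\{1,\dots,M_p\}$ for $p\ne r$ and put $$a=\prod_{p\neq r}\frac{c_p}{(M_p-L_p+1)^2L_p^2},\qquad c_p=\tfrac13(m_p+1)\big(m_p(2m_p-3M_p-2)+6(M_p-L_p+1)L_p\big)-(M_p-L_p+1)L_p,\quad m_p=\min\{L_p,M_p-L_p\}.$$ Then, for each of the four algorithms: 1. $\displaystyle \mathrm{MSE}^{(r)}=\frac1{\hat\rho}\cdot\frac{M_r}{M(M_r-1)^2}$. 2. As a function of $L_r\in\{1,\dots,M_r-1\}$, $\mathrm{MSE}^{(r)}_{\rm SS}$ is minimal exactly at $L_r=L_r^{\rm opt}$ and at $L_r=M_r-L_r^{\rm opt}$, where $L_r^{\rm opt}=\frac{M_r}3,\ \frac{M_r-1}3,\ \frac{M_r+1}3$ for $M_r\equiv0,1,2\pmod 3$, respectively. 3. At either of these values the gain $\eta^{(r)}_{\rm SS}=\mathrm{MSE}^{(r)}/\mathrm{MSE}^{(r)}_{\rm SS}(L_r)$ is $$\eta^{(r)}_{\rm SS}=\begin{cases}\dfrac4{27}\cdot\dfrac{M_r^4}{(M_r-1)^2}\cdot\dfrac1{Ma}&\text{if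 }M_r\equiv0\pmod 3,\\[2mm]\dfrac4{27}\cdot\dfrac{M_r(M_r+\frac12)^2}{M_r-1}\cdot\dfrac1{Ma}&\text{if }M_r\equiv1\pmod 3,\\[2mm]\dfrac4{27}\cdot\dfrac{M_r(M_r-\frac12)^2(M_r+1)}{(M_r-1)^2\,M a}&\text{if }M_r\equiv2\pmod 3.\end{cases}$$ -/

import Mathlib

open MeasureTheory Matrix Finset

noncomputable section

namespace SpatialSmoothing

/-! ## Uniform `R`-dimensional grids and selection matrices -/

/-- Positions on an `m 0 × ⋯ × m (R-1)` grid (zero-based).  A Kronecker product over the modes is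
written with such multi-indices instead of a linear ordering of the grid. -/
abbrev Idx {R : ℕ} (m : Fin R → ℕ) : Type := ∀ p, Fin (m p)

/-- The multi-dimensional selection matrix picking the block of shape `m'` with offset `o` out of a
grid of shape `m`, that is the Kronecker product over the modes `p` of the
`m' p × m p` matrices `[0 I 0]` with `o p` zero columns on the left. -/
def selMatrix {R : ℕ} (m' m o : Fin R → ℕ) : Matrix (Idx m') (Idx m) ℂ :=
  fun i j => ∏ p, if (j p : ℕ) = (i p : ℕ) + o p then 1 else 0

/-- Reversal of all coordinates (the index form of the exchange matrix `Π`). -/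
def revIdx {R : ℕ} {m : Fin R → ℕ} (i : Idx m) : Idx m := fun p => (i p).rev

/-- Number of sensors per mode of each of the `L p` maximally overlapping subarrays. -/
def subSize {R : ℕ} (M L : Fin R → ℕ) : Fin R → ℕ := fun p => M p - L p + 1

/-! ## Single-source data model -/

/-- Array steering vector of a uniform `R`-D array at the spatial frequencies `μ`, with the phase
reference of mode `p` shifted by `δ p` away from the centroid. -/
def steering {R : ℕ} (M : Fin R → ℕ) (μ δ : Fin R → ℝ) : Idx M → ℂ :=
  fun i => ∏ p,
    Complex.exp (Complex.I * ((((i p : ℕ) : ℝ) - ((M p : ℝ) - 1) / 2 + δ p) * μ p : ℝ))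

/-- Noise-free measurement matrix `a(μ) sᵀ` of one source with symbols `s`. -/
def signal {R N : ℕ} (M : Fin R → ℕ) (μ δ : Fin R → ℝ) (s : Fin N → ℂ) :
    Matrix (Idx M) (Fin N) ℂ :=
  vecMulVec (steering M μ δ) s

/-- Zero-mean circularly symmetric white noise of variance `v` with finite second moments. -/
structure IsCircularWhiteNoise {R N : ℕ} {M : Fin R → ℕ} {Ω : Type*} [MeasurableSpace Ω]
    (P : Measure Ω) (W : Ω → Matrix (Idx M) (Fin N) ℂ) (v : ℝ) : Prop where
  memLp : ∀ i n, MemLp (fun ω => W ω i n) 2 P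
  mean_zero : ∀ i n, ∫ ω, W ω i n ∂P = 0
  covariance : ∀ i n j k,
    ∫ ω, W ω i n * star (W ω j k) ∂P = if i = j ∧ n = k then (v : ℂ) else 0
  pseudoCovariance : ∀ i n j k, ∫ ω, W ω i n * W ω j k ∂P = 0

/-- Effective SNR `N P̂ / v`, with empirical source power `P̂ = ‖s‖² / N`. -/
def effectiveSNR {N : ℕ} (s : Fin N → ℂ) (v : ℝ) : ℝ :=
  (N : ℝ) * ((∑ n, ‖s n‖ ^ 2) / (N : ℝ)) / v

/-! ## Preprocessing of a data matrix -/

/-- Spatial smoothing: the blocks `J_ℓ X` for all subarrays `ℓ`, placed side by side. -/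
def smooth {R N : ℕ} (M L : Fin R → ℕ) (X : Matrix (Idx M) (Fin N) ℂ) :
    Matrix (Idx (subSize M L)) (Idx L × Fin N) ℂ :=
  fun i c => (selMatrix (subSize M L) M (fun p => (c.1 p : ℕ)) * X) i c.2

/-- The matrix `Π X*` with `Π` the exchange matrix and `*` entrywise conjugation. -/
def flipConj {R N : ℕ} {M : Fin R → ℕ} (X : Matrix (Idx M) (Fin N) ℂ) :
    Matrix (Idx M) (Fin N) ℂ :=
  fun i n => star (X (revIdx i) n)

/-- Preprocessing for strictly non-circular sources, `[X; Π X*]`. -/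
def ncAugment {R N : ℕ} {M : Fin R → ℕ} (X : Matrix (Idx M) (Fin N) ℂ) :
    Matrix (Idx M ⊕ Idx M) (Fin N) ℂ :=
  fromRows X (flipConj X)

/-- Spatial smoothing of augmented data, by the selection matrices `I₂ ⊗ J_ℓ`. -/
def ncSmooth {R N : ℕ} (M L : Fin R → ℕ) (X : Matrix (Idx M ⊕ Idx M) (Fin N) ℂ) :
    Matrix (Idx (subSize M L) ⊕ Idx (subSize M L)) (Idx L × Fin N) ℂ :=
  fromRows (smooth M L X.toRows₁) (smooth M L X.toRows₂)

/-- Forward-backward averaging `[Y, Π Y* Π]`, where `πI`, `πK` reverse the rows and columns. -/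
def fba {I K : Type*} (πI : I → I) (πK : K → K) (Y : Matrix I K ℂ) : Matrix I (K ⊕ K) ℂ :=
  fromCols Y (fun i k => star (Y (πI i) (πK k)))

/-- Reversal of the columns of smoothed data. -/
def revCol {R N : ℕ} {L : Fin R → ℕ} (c : Idx L × Fin N) : Idx L × Fin N :=
  (revIdx c.1, c.2.rev)

/-- Reversal of the rows of augmented data; it also exchanges the two blocks. -/
def revNC {R : ℕ} {m : Fin R → ℕ} (i : Idx m ⊕ Idx m) : Idx m ⊕ Idx m :=
  (i.map revIdx revIdx).swap

/-! ## Shift-invariance selection matrices -/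

/-- Shape of the two maximally overlapping shift-invariant parts, in mode `r`, of a grid. -/
def shiftSize {R : ℕ} (r : Fin R) (m : Fin R → ℕ) : Fin R → ℕ :=
  Function.update m r (m r - 1)

/-- Selection of the first `m r - 1` elements in mode `r`. -/
def shiftFst {R : ℕ} (r : Fin R) (m : Fin R → ℕ) : Matrix (Idx (shiftSize r m)) (Idx m) ℂ :=
  selMatrix (shiftSize r m) m 0

/-- Selection of the last `m r - 1` elements in mode `r`. -/
def shiftSnd {R : ℕ} (r : Fin R) (m : Fin R → ℕ) : Matrix (Idx (shiftSize r m)) (Idx m) ℂ :=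
  selMatrix (shiftSize r m) m (Pi.single r 1)

/-- `I₂ ⊗ J`. -/
def twice {I' I : Type*} (J : Matrix I' I ℂ) : Matrix (I' ⊕ I') (I ⊕ I) ℂ :=
  fromBlocks J 0 0 J

/-! ## First-order estimation error of ESPRIT for one source -/

/-- A compact singular value decomposition `X = σ u vᴴ` of a matrix of rank one. -/
structure RankOneSVD {I K : Type*} [Fintype I] [Fintype K] (X : Matrix I K ℂ) where
  u : I → ℂ
  v : K → ℂ
  σ : ℝ
  norm_u : star u ⬝ᵥ u = 1
  norm_v : star v ⬝ᵥ v = 1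
  pos : 0 < σ
  eq : X = (σ : ℂ) • vecMulVec u (star v)

section FirstOrder

variable {I I' K : Type*} [Fintype I] [DecidableEq I] [Fintype I'] [Fintype K]

/-- First-order signal subspace error `Uₙ Uₙᴴ E v σ⁻¹` caused by the perturbation `E`; here
`Uₙ Uₙᴴ = 1 - u uᴴ` is the projection onto the noise subspace. -/
def subspaceError {X : Matrix I K ℂ} (D : RankOneSVD X) (E : Matrix I K ℂ) : I → ℂ :=
  (D.σ : ℂ)⁻¹ • ((1 - vecMulVec D.u (star D.u)) *ᵥ (E *ᵥ D.v))

/-- `b⁺ y`, where `b⁺ = bᴴ / (bᴴ b)` is the Moore-Penrose inverse of the column `b ≠ 0`. -/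
def pinvMul (b y : I' → ℂ) : ℂ := (star b ⬝ᵥ y) / (star b ⬝ᵥ b)

/-- First-order error `Im {(J₁ u)⁺ (J₂ / λ - J₁) Δu}`, `λ = exp (i μ)`, of the spatial frequency
`μ` obtained from the least squares solution of `J₁ u Γ ≈ J₂ u`. -/
def freqError (J₁ J₂ : Matrix I' I ℂ) (μ : ℝ) {X : Matrix I K ℂ} (D : RankOneSVD X)
    (E : Matrix I K ℂ) : ℝ :=
  (pinvMul (J₁ *ᵥ D.u)
    (((Complex.exp (Complex.I * μ))⁻¹ • J₂ - J₁) *ᵥ subspaceError D E)).im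

open Classical in
/-- First-order mean squared error `E{(Δμ)²}` for noise-free data `X` and random perturbation `E`.
The value does not depend on the choice of the singular value decomposition, which is unique up
to a common phase of `u` and `v`. -/
def firstOrderMSE (J₁ J₂ : Matrix I' I ℂ) (μ : ℝ) (X : Matrix I K ℂ)
    {Ω : Type*} [MeasurableSpace Ω] (P : Measure Ω) (E : Ω → Matrix I K ℂ) : ℝ :=
  if h : Nonempty (RankOneSVD X) then ∫ ω, freqError J₁ J₂ μ h.some (E ω) ^ 2 ∂P else 0

end FirstOrder

/-! ## The four algorithms -/

/-- `R`-D Standard ESPRIT, `R`-D Unitary ESPRIT and their versions for strictly non-circular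
sources, all with least squares. -/
inductive Algorithm
  | standard
  | unitary
  | ncStandard
  | ncUnitary

/-- Whether the algorithm is meant for strictly non-circular sources only. -/
def Algorithm.IsNC : Algorithm → Prop
  | .standard => False
  | .unitary => False
  | .ncStandard => True
  | .ncUnitary => True

/-- Asymptotic (first-order) MSE of the frequency `μ r` when the algorithm is applied to
spatially smoothed data with `L p` subarrays in mode `p`.  The first-order behaviour of the unitary
versions is that of the standard versions after forward-backward averaging. -/
def mseSS (alg : Algorithm) {R N : ℕ} (r : Fin R) (M L : Fin R → ℕ) (μ δ : Fin R → ℝ)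
    (s : Fin N → ℂ) {Ω : Type*} [MeasurableSpace Ω] (P : Measure Ω)
    (W : Ω → Matrix (Idx M) (Fin N) ℂ) : ℝ :=
  let J₁ := shiftFst r (subSize M L)
  let J₂ := shiftSnd r (subSize M L)
  let X := signal M μ δ s
  match alg with
  | .standard =>
      firstOrderMSE J₁ J₂ (μ r) (smooth M L X) P (fun ω => smooth M L (W ω))
  | .unitary =>
      firstOrderMSE J₁ J₂ (μ r) (fba revIdx revCol (smooth M L X)) P
        (fun ω => fba revIdx revCol (smooth M L (W ω)))
  | .ncStandard =>
      firstOrderMSE (twice J₁) (twice J₂) (μ r) (ncSmooth M L (ncAugment X)) P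
        (fun ω => ncSmooth M L (ncAugment (W ω)))
  | .ncUnitary =>
      firstOrderMSE (twice J₁) (twice J₂) (μ r)
        (fba revNC revCol (ncSmooth M L (ncAugment X))) P
        (fun ω => fba revNC revCol (ncSmooth M L (ncAugment (W ω))))

/-- Asymptotic MSE without spatial smoothing: a single subarray, the full array, in each mode. -/
def mseNoSS (alg : Algorithm) {R N : ℕ} (r : Fin R) (M : Fin R → ℕ) (μ δ : Fin R → ℝ)
    (s : Fin N → ℂ) {Ω : Type*} [MeasurableSpace Ω] (P : Measure Ω)
    (W : Ω → Matrix (Idx M) (Fin N) ℂ) : ℝ :=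
  mseSS alg r M (fun _ => 1) μ δ s P W

/-! ## Closed forms -/

/-- The constant `c_p` of a mode with `M` sensors and `L` subarrays. -/
def cConst (M L : ℝ) : ℝ :=
  1 / 3 * (min L (M - L) + 1) *
      (min L (M - L) * (2 * min L (M - L) - 3 * M - 2) + 6 * (M - L + 1) * L)
    - (M - L + 1) * L

/-- The factor `a = ∏_{p ≠ r} c_p / ((M_p - L_p + 1)² L_p²)`. -/
def aConst {R : ℕ} (r : Fin R) (M L : Fin R → ℕ) : ℝ :=
  ∏ p ∈ univ.erase r,
    cConst (M p) (L p) / (((M p : ℝ) - (L p : ℝ) + 1) ^ 2 * (L p : ℝ) ^ 2)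

/-- `m / 3` rounded to the nearest integer. -/
def Lopt (m : ℕ) : ℕ :=
  if m % 3 = 0 then m / 3 else if m % 3 = 1 then (m - 1) / 3 else (m + 1) / 3

/-- The closed form of the maximum gain; `m = M_r`, `Mtot = M`. -/
def gainFormula (m : ℕ) (Mtot a : ℝ) : ℝ :=
  if m % 3 = 0 then
    4 / 27 * ((m : ℝ) ^ 4 / ((m : ℝ) - 1) ^ 2) * (1 / (Mtot * a))
  else if m % 3 = 1 then
    4 / 27 * ((m : ℝ) * ((m : ℝ) + 1 / 2) ^ 2 / ((m : ℝ) - 1)) * (1 / (Mtot * a))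
  else
    4 / 27 * ((m : ℝ) * ((m : ℝ) - 1 / 2) ^ 2 * ((m : ℝ) + 1) / (((m : ℝ) - 1) ^ 2 * Mtot * a))

end SpatialSmoothing

end

set_option linter.unusedSectionVars false

/-! Shift invariance gives `(J₂ / λ - J₁) u = 0`, so the noise-subspace projection drops out of the
error. Multiplying numerator and denominator by `σ²` then turns the error into the imaginary part of
a Frobenius inner product divided by a Frobenius norm (`freqError_eq`), in which the decomposition
no longer appears.

Appending a reversed conjugate copy, as extra columns (forward-backward averaging) or as extra rows
(non-circular augmentation), adds `-conj z` to the inner product `z` and doubles the norm. The ratio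
is unchanged, so all four algorithms have the same error for each noise realization
(`fromCols_conjReindex`, `fromRows_conjReindex`).

For the standard algorithm the inner product is linear in the noise, and the weight at a sensor
counts the ways to reach it as subarray element plus subarray offset (`crossTerm_smooth_signal`).
Circular white noise makes the MSE proportional to the sum of squared weights (`integral_im_sq`),
which factors over the modes. A mode other than `r` contributes the energy of a trapezoid, namely
`cConst`; mode `r` contributes a difference of two shifted trapezoids, with energy `2 min (L, M -
L)`.

In `l = L r` and `m = M r` the MSE is thus a positive constant times `min (l, m - l) / ((m - l)²
l²)`. This is symmetric under `l ↦ m - l` and equals `1 / (l (m - l)²)` for `2 l ≤ m`, so it remains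
to maximize a cubic with real maximizer `m / 3` over the integers (`score_lt`). -/

namespace SpatialSmoothing

/-! ### The first-order error without the singular value decomposition -/

section FirstOrder

variable {I I' K : Type*} [Fintype I] [Fintype I'] [Fintype K]

/-- The inner product of `J₁ X` and `(J₂ / λ - J₁) E`, with `λ = exp (i μ)`. -/
noncomputable def crossTerm (J₁ J₂ : Matrix I' I ℂ) (μ : ℝ) (X E : Matrix I K ℂ) : ℂ :=
  ∑ i, ∑ k, star ((J₁ * X) i k) *
    ((Complex.exp (Complex.I * μ))⁻¹ * (J₂ * E) i k - (J₁ * E) i k)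

/-- The squared Frobenius norm of `J₁ X`. -/
noncomputable def shiftPower (J₁ : Matrix I' I ℂ) (X : Matrix I K ℂ) : ℝ :=
  ∑ i, ∑ k, ‖(J₁ * X) i k‖ ^ 2

lemma mul_star_self_eq (z : ℂ) : star z * z = ((‖z‖ ^ 2 : ℝ) : ℂ) := by
  rw [Complex.star_def, mul_comm, Complex.mul_conj, Complex.normSq_eq_norm_sq]

/-- Since `X v = σ u`, shift invariance of `X` passes to `u`; the remaining `u`, `v`, `σ` recombine
into `J₁ X`. -/
lemma freqError_eq [DecidableEq I] (J₁ J₂ : Matrix I' I ℂ) (μ : ℝ) {X : Matrix I K ℂ}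
    (h : J₂ * X = Complex.exp (Complex.I * μ) • (J₁ * X)) (D : RankOneSVD X)
    (E : Matrix I K ℂ) :
    freqError J₁ J₂ μ D E = (crossTerm J₁ J₂ μ X E).im / shiftPower J₁ X := by
  obtain ⟨u, v, σ, hu, hv, hσ, hX⟩ := D
  set c := Complex.exp (Complex.I * μ) with hc
  have hc0 : c ≠ 0 := Complex.exp_ne_zero _
  have hσ0 : (σ : ℂ) ≠ 0 := by exact_mod_cast hσ.ne'
  have hv' : star v ⬝ᵥ v = 1 := hv
  have hXv : X *ᵥ v = (σ : ℂ) • u := by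
    rw [hX, smul_mulVec, vecMulVec_mulVec]
    simp [hv']
  have hB : (c⁻¹ • J₂ - J₁) *ᵥ u = 0 := by
    have h1 : (c⁻¹ • J₂ - J₁) * X = 0 := by
      rw [Matrix.sub_mul, Matrix.smul_mul, h, smul_smul, inv_mul_cancel₀ hc0, one_smul, sub_self]
    have h2 : (σ : ℂ) • ((c⁻¹ • J₂ - J₁) *ᵥ u) = 0 := by
      rw [← mulVec_smul, ← hXv, mulVec_mulVec, h1, zero_mulVec]
    exact (smul_eq_zero.mp h2).resolve_left hσ0
  have hJX : ∀ i k, (J₁ * X) i k = σ * ((J₁ *ᵥ u) i * star (v k)) := by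
    intro i k
    rw [hX, Matrix.mul_smul, Matrix.mul_vecMulVec]
    simp [vecMulVec_apply]
  -- The part of `E v` along `u` is annihilated, by `hB`, so the projection may be omitted.
  have hy : (c⁻¹ • J₂ - J₁) *ᵥ ((σ : ℂ)⁻¹ • ((1 - vecMulVec u (star u)) *ᵥ (E *ᵥ v))) =
      (σ : ℂ)⁻¹ • ((c⁻¹ • (J₂ * E) - J₁ * E) *ᵥ v) := by
    rw [mulVec_smul, sub_mulVec (1 : Matrix I I ℂ), one_mulVec, mulVec_sub, vecMulVec_mulVec]
    have : (c⁻¹ • J₂ - J₁) *ᵥ (MulOpposite.op (star u ⬝ᵥ E *ᵥ v) • u) = 0 := by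
      rw [op_smul_eq_smul, mulVec_smul, hB, smul_zero]
    rw [this, sub_zero, mulVec_mulVec, Matrix.sub_mul, Matrix.smul_mul]
  have hcr : crossTerm J₁ J₂ μ X E =
      σ * (star (J₁ *ᵥ u) ⬝ᵥ ((c⁻¹ • (J₂ * E) - J₁ * E) *ᵥ v)) := by
    unfold crossTerm
    simp only [hJX, dotProduct, mulVec, Finset.mul_sum, ← hc]
    refine Finset.sum_congr rfl fun i _ => Finset.sum_congr rfl fun k _ => ?_
    simp only [Pi.star_apply, Matrix.sub_apply, Matrix.smul_apply, smul_eq_mul, star_mul',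
      Complex.star_def, Complex.conj_ofReal, Complex.conj_conj]
    simp only [mulVec, dotProduct]
    ring
  have hsp : ((shiftPower J₁ X : ℝ) : ℂ) = σ ^ 2 * (star (J₁ *ᵥ u) ⬝ᵥ (J₁ *ᵥ u)) := by
    -- The factor `vᴴ v = 1` supplies the column sum of the Frobenius norm.
    have : (σ : ℂ) ^ 2 * (star (J₁ *ᵥ u) ⬝ᵥ (J₁ *ᵥ u)) =
        σ ^ 2 * (star (J₁ *ᵥ u) ⬝ᵥ (J₁ *ᵥ u)) * (star v ⬝ᵥ v) := by rw [hv', mul_one]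
    rw [this]
    unfold shiftPower
    push_cast
    simp only [← Complex.ofReal_pow, ← mul_star_self_eq, hJX]
    simp only [dotProduct, Finset.mul_sum, Finset.sum_mul]
    rw [Finset.sum_comm]
    refine Finset.sum_congr rfl fun i _ => Finset.sum_congr rfl fun k _ => ?_
    simp only [Pi.star_apply, star_mul', Complex.star_def, Complex.conj_ofReal,
      Complex.conj_conj, Complex.ofReal_pow]
    ring
  have : pinvMul (J₁ *ᵥ u) ((c⁻¹ • J₂ - J₁) *ᵥ
      ((σ : ℂ)⁻¹ • ((1 - vecMulVec u (star u)) *ᵥ (E *ᵥ v)))) =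
      crossTerm J₁ J₂ μ X E / ((shiftPower J₁ X : ℝ) : ℂ) := by
    rw [hy, hcr, hsp]
    unfold pinvMul
    rw [dotProduct_smul, smul_eq_mul]
    -- If `J₁ u` vanishes, both sides are divisions by zero and equal `0`.
    by_cases hz : star (J₁ *ᵥ u) ⬝ᵥ (J₁ *ᵥ u) = 0
    · simp [hz]
    · field_simp
  unfold freqError subspaceError
  rw [← hc, this, Complex.div_ofReal_im]

/-! ### Existence of the compact decomposition for an outer product -/

lemma sum_norm_sq_pos {x : I → ℂ} (hx : x ≠ 0) : 0 < ∑ i, ‖x i‖ ^ 2 := by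
  obtain ⟨i, hi⟩ := Function.ne_iff.mp hx
  exact Finset.sum_pos' (fun _ _ => by positivity) ⟨i, mem_univ i, by
    have : 0 < ‖x i‖ := norm_pos_iff.mpr hi
    positivity⟩

lemma star_dotProduct_self_eq (x : I → ℂ) : star x ⬝ᵥ x = ((∑ i, ‖x i‖ ^ 2 : ℝ) : ℂ) := by
  push_cast
  simp only [dotProduct, Pi.star_apply, ← Complex.ofReal_pow, ← mul_star_self_eq]

lemma exists_normalization {z : I → ℂ} (hz : z ≠ 0) :
    ∃ a : ℝ, 0 < a ∧ star ((a : ℂ)⁻¹ • z) ⬝ᵥ ((a : ℂ)⁻¹ • z) = 1 := by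
  have hp := sum_norm_sq_pos hz
  refine ⟨√(∑ i, ‖z i‖ ^ 2), Real.sqrt_pos.mpr hp, ?_⟩
  rw [star_smul, smul_dotProduct, dotProduct_smul, star_dotProduct_self_eq]
  simp only [smul_eq_mul, star_inv₀, Complex.star_def, Complex.conj_ofReal]
  rw [← mul_assoc, ← mul_inv, ← Complex.ofReal_mul, Real.mul_self_sqrt hp.le]
  exact inv_mul_cancel₀ (by exact_mod_cast hp.ne')

lemma nonempty_rankOneSVD {x : I → ℂ} {y : K → ℂ} (hx : x ≠ 0) (hy : y ≠ 0) :
    Nonempty (RankOneSVD (vecMulVec x y)) := by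
  obtain ⟨a, ha, ha'⟩ := exists_normalization hx
  obtain ⟨b, hb, hb'⟩ := exists_normalization (star_ne_zero.mpr hy)
  refine ⟨⟨_, _, a * b, ha', hb', mul_pos ha hb, ?_⟩⟩
  have ha0 : (a : ℂ) ≠ 0 := by exact_mod_cast ha.ne'
  have hb0 : (b : ℂ) ≠ 0 := by exact_mod_cast hb.ne'
  ext i k
  simp [vecMulVec_apply]
  field_simp

/-- The arbitrary choice of decomposition is harmless, because `freqError_eq` gives the same value
for every one. The rank-one form of `X` serves only to show that one exists. -/
lemma firstOrderMSE_eq [DecidableEq I] (J₁ J₂ : Matrix I' I ℂ) (μ : ℝ) {X : Matrix I K ℂ}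
    (h : J₂ * X = Complex.exp (Complex.I * μ) • (J₁ * X)) {x : I → ℂ} {y : K → ℂ}
    (hx : x ≠ 0) (hy : y ≠ 0) (hX : X = vecMulVec x y)
    {Ω : Type*} [MeasurableSpace Ω] (P : Measure Ω) (E : Ω → Matrix I K ℂ) :
    firstOrderMSE J₁ J₂ μ X P E =
      ∫ ω, ((crossTerm J₁ J₂ μ X (E ω)).im / shiftPower J₁ X) ^ 2 ∂P := by
  have hn : Nonempty (RankOneSVD X) := hX ▸ nonempty_rankOneSVD hx hy
  unfold firstOrderMSE
  rw [dif_pos hn]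
  convert rfl using 4
  · exact (freqError_eq J₁ J₂ μ h _ _).symm

/-! ## Reversal, duplication of the columns, duplication of the rows -/

/-- The entrywise conjugate of `Y` with the rows and columns permuted. -/
def conjReindex (πI : I → I) (πK : K → K) (Y : Matrix I K ℂ) : Matrix I K ℂ :=
  fun i k => star (Y (πI i) (πK k))

/-- The pair `(J₁, J₂)` is exchanged by reversal of rows and columns. -/
structure IsReversalPair (J₁ J₂ : Matrix I' I ℂ) (π' : I' ≃ I') (π : I ≃ I) : Prop where
  star_fst : ∀ i j, star (J₁ i j) = J₁ i j
  star_snd : ∀ i j, star (J₂ i j) = J₂ i j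
  fst : ∀ i j, J₁ (π' i) (π j) = J₂ i j
  snd : ∀ i j, J₂ (π' i) (π j) = J₁ i j
  invol_rows : ∀ i, π' (π' i) = i
  invol : ∀ j, π (π j) = j

namespace IsReversalPair

variable {J₁ J₂ : Matrix I' I ℂ} {π' : I' ≃ I'} {π : I ≃ I}

lemma symm (h : IsReversalPair J₁ J₂ π' π) : IsReversalPair J₂ J₁ π' π :=
  ⟨h.star_snd, h.star_fst, h.snd, h.fst, h.invol_rows, h.invol⟩

lemma fst_mul (h : IsReversalPair J₁ J₂ π' π) (πK : K → K) (Y : Matrix I K ℂ) (i : I') (k : K) :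
    (J₁ * conjReindex π πK Y) i k = star ((J₂ * Y) (π' i) (πK k)) := by
  rw [Matrix.mul_apply, Matrix.mul_apply, star_sum, ← Equiv.sum_comp π]
  refine Finset.sum_congr rfl fun j _ => ?_
  rw [star_mul', h.star_snd, conjReindex, h.invol, ← h.fst, h.invol_rows]

/-- Reversal exchanges `J₁` and `J₂` and conjugates the entries. Shift invariance turns `J₂ X` back
into `λ J₁ X`, and since `|λ| = 1` the two noise terms trade places; this is the source of the minus
sign. -/
lemma crossTerm_conjReindex (h : IsReversalPair J₁ J₂ π' π) (πK : K ≃ K) (μ : ℝ)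
    {X : Matrix I K ℂ} (hX : J₂ * X = Complex.exp (Complex.I * μ) • (J₁ * X))
    (E : Matrix I K ℂ) :
    crossTerm J₁ J₂ μ (conjReindex π πK X) (conjReindex π πK E) =
      - star (crossTerm J₁ J₂ μ X E) := by
  have hc0 : Complex.exp (Complex.I * μ) ≠ 0 := Complex.exp_ne_zero _
  have hcs : star (Complex.exp (Complex.I * μ)) = (Complex.exp (Complex.I * μ))⁻¹ := by
    rw [Complex.star_def, ← Complex.exp_conj, ← Complex.exp_neg]
    simp
  unfold crossTerm
  simp only [h.fst_mul, h.symm.fst_mul]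
  rw [Equiv.sum_comp π' (fun i => ∑ k, star (star ((J₂ * X) i (πK k))) *
    ((Complex.exp (Complex.I * μ))⁻¹ * star ((J₁ * E) i (πK k)) - star ((J₂ * E) i (πK k))))]
  rw [star_sum, ← Finset.sum_neg_distrib]
  refine Finset.sum_congr rfl fun i _ => ?_
  rw [Equiv.sum_comp πK (fun k => star (star ((J₂ * X) i k)) *
    ((Complex.exp (Complex.I * μ))⁻¹ * star ((J₁ * E) i k) - star ((J₂ * E) i k)))]
  rw [star_sum, ← Finset.sum_neg_distrib]
  refine Finset.sum_congr rfl fun k _ => ?_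
  rw [hX, Matrix.smul_apply, smul_eq_mul]
  simp only [star_sub, star_star, star_mul', hcs, star_inv₀, inv_inv]
  field_simp
  ring

lemma shiftPower_conjReindex (h : IsReversalPair J₁ J₂ π' π) (πK : K ≃ K) (μ : ℝ)
    {X : Matrix I K ℂ} (hX : J₂ * X = Complex.exp (Complex.I * μ) • (J₁ * X)) :
    shiftPower J₁ (conjReindex π πK X) = shiftPower J₁ X := by
  unfold shiftPower
  simp only [h.fst_mul, norm_star]
  rw [Equiv.sum_comp π' (fun i => ∑ k, ‖(J₂ * X) i (πK k)‖ ^ 2)]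
  refine Finset.sum_congr rfl fun i _ => ?_
  rw [Equiv.sum_comp πK (fun k => ‖(J₂ * X) i k‖ ^ 2), hX]
  simp [mul_comm Complex.I, Complex.norm_exp_ofReal_mul_I]

lemma snd_mul_conjReindex (h : IsReversalPair J₁ J₂ π' π) (πK : K ≃ K) (μ : ℝ)
    {X : Matrix I K ℂ} (hX : J₂ * X = Complex.exp (Complex.I * μ) • (J₁ * X)) :
    J₂ * conjReindex π πK X = Complex.exp (Complex.I * μ) • (J₁ * conjReindex π πK X) := by
  have hcs : star (Complex.exp (Complex.I * μ)) = (Complex.exp (Complex.I * μ))⁻¹ := by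
    rw [Complex.star_def, ← Complex.exp_conj, ← Complex.exp_neg]
    simp
  ext i k
  rw [Matrix.smul_apply, h.fst_mul, h.symm.fst_mul, hX, Matrix.smul_apply]
  rw [smul_eq_mul, smul_eq_mul, star_mul', hcs, mul_inv_cancel_left₀ (Complex.exp_ne_zero _)]

end IsReversalPair

lemma crossTerm_fromCols {K' : Type*} [Fintype K'] (J₁ J₂ : Matrix I' I ℂ) (μ : ℝ)
    (A E : Matrix I K ℂ) (B F : Matrix I K' ℂ) :
    crossTerm J₁ J₂ μ (fromCols A B) (fromCols E F) =
      crossTerm J₁ J₂ μ A E + crossTerm J₁ J₂ μ B F := by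
  simp only [crossTerm, Matrix.mul_fromCols, Fintype.sum_sum_type, fromCols_apply_inl,
    fromCols_apply_inr, Finset.sum_add_distrib]

lemma shiftPower_fromCols {K' : Type*} [Fintype K'] (J₁ : Matrix I' I ℂ)
    (A : Matrix I K ℂ) (B : Matrix I K' ℂ) :
    shiftPower J₁ (fromCols A B) = shiftPower J₁ A + shiftPower J₁ B := by
  simp only [shiftPower, Matrix.mul_fromCols, Fintype.sum_sum_type, fromCols_apply_inl,
    fromCols_apply_inr, Finset.sum_add_distrib]

lemma twice_mul_fromRows (J : Matrix I' I ℂ) (A B : Matrix I K ℂ) :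
    twice J * fromRows A B = fromRows (J * A) (J * B) := by
  simp [twice, fromBlocks_mul_fromRows]

lemma crossTerm_twice (J₁ J₂ : Matrix I' I ℂ) (μ : ℝ) (A B E F : Matrix I K ℂ) :
    crossTerm (twice J₁) (twice J₂) μ (fromRows A B) (fromRows E F) =
      crossTerm J₁ J₂ μ A E + crossTerm J₁ J₂ μ B F := by
  simp only [crossTerm, twice_mul_fromRows, Fintype.sum_sum_type, fromRows_apply_inl,
    fromRows_apply_inr]

lemma shiftPower_twice (J₁ : Matrix I' I ℂ) (A B : Matrix I K ℂ) :
    shiftPower (twice J₁) (fromRows A B) = shiftPower J₁ A + shiftPower J₁ B := by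
  simp only [shiftPower, twice_mul_fromRows, Fintype.sum_sum_type, fromRows_apply_inl,
    fromRows_apply_inr]

namespace IsReversalPair

variable {J₁ J₂ : Matrix I' I ℂ} {π' : I' ≃ I'} {π : I ≃ I}

/-- The cross term becomes `z - conj z`, with imaginary part `2 Im z`, while the power doubles. The
factors of two cancel. -/
lemma fromCols_conjReindex (h : IsReversalPair J₁ J₂ π' π) (πK : K ≃ K) (μ : ℝ)
    {X : Matrix I K ℂ} (hX : J₂ * X = Complex.exp (Complex.I * μ) • (J₁ * X))
    (E : Matrix I K ℂ) :
    J₂ * fromCols X (conjReindex π πK X) =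
        Complex.exp (Complex.I * μ) • (J₁ * fromCols X (conjReindex π πK X)) ∧
      (crossTerm J₁ J₂ μ (fromCols X (conjReindex π πK X))
          (fromCols E (conjReindex π πK E))).im /
          shiftPower J₁ (fromCols X (conjReindex π πK X)) =
        (crossTerm J₁ J₂ μ X E).im / shiftPower J₁ X := by
  constructor
  · rw [Matrix.mul_fromCols, Matrix.mul_fromCols, h.snd_mul_conjReindex πK μ hX, hX]
    ext i (k | k) <;> simp
  · rw [crossTerm_fromCols, shiftPower_fromCols, h.crossTerm_conjReindex πK μ hX,
      h.shiftPower_conjReindex πK μ hX]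
    simp only [Complex.add_im, Complex.neg_im, Complex.star_def, Complex.conj_im, neg_neg]
    rw [← two_mul, ← two_mul, mul_div_mul_left _ _ two_ne_zero]

lemma fromRows_conjReindex (h : IsReversalPair J₁ J₂ π' π) (πK : K ≃ K) (μ : ℝ)
    {X : Matrix I K ℂ} (hX : J₂ * X = Complex.exp (Complex.I * μ) • (J₁ * X))
    (E : Matrix I K ℂ) :
    twice J₂ * fromRows X (conjReindex π πK X) =
        Complex.exp (Complex.I * μ) • (twice J₁ * fromRows X (conjReindex π πK X)) ∧
      (crossTerm (twice J₁) (twice J₂) μ (fromRows X (conjReindex π πK X))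
          (fromRows E (conjReindex π πK E))).im /
          shiftPower (twice J₁) (fromRows X (conjReindex π πK X)) =
        (crossTerm J₁ J₂ μ X E).im / shiftPower J₁ X := by
  constructor
  · rw [twice_mul_fromRows, twice_mul_fromRows, h.snd_mul_conjReindex πK μ hX, hX]
    ext (i | i) k <;> simp
  · rw [crossTerm_twice, shiftPower_twice, h.crossTerm_conjReindex πK μ hX,
      h.shiftPower_conjReindex πK μ hX]
    simp only [Complex.add_im, Complex.neg_im, Complex.star_def, Complex.conj_im, neg_neg]
    rw [← two_mul, ← two_mul, mul_div_mul_left _ _ two_ne_zero]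

/-- Doubling the rows by `I₂ ⊗ J`, with exchange of the two blocks. -/
lemma twice (h : IsReversalPair J₁ J₂ π' π) :
    IsReversalPair (twice J₁) (twice J₂) ((Equiv.sumCongr π' π').trans (Equiv.sumComm I' I'))
      ((Equiv.sumCongr π π).trans (Equiv.sumComm I I)) where
  star_fst := by rintro (i | i) (j | j) <;> simp [SpatialSmoothing.twice, h.star_fst, - RCLike.star_def]
  star_snd := by rintro (i | i) (j | j) <;> simp [SpatialSmoothing.twice, h.star_snd, - RCLike.star_def]
  fst := by rintro (i | i) (j | j) <;> simp [SpatialSmoothing.twice, h.fst]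
  snd := by rintro (i | i) (j | j) <;> simp [SpatialSmoothing.twice, h.snd]
  invol_rows := by rintro (i | i) <;> simp [h.invol_rows]
  invol := by rintro (i | i) <;> simp [h.invol]

end IsReversalPair

end FirstOrder

/-! ## Second moments of white noise -/

/-- Separates the covariance part from the pseudo-covariance part, which circularity kills. -/
lemma im_sq_eq (z : ℂ) : z.im ^ 2 = 1 / 2 * (z * star z - z * z).re := by
  simp [Complex.mul_re]
  ring

/-- After expansion into a double sum only the diagonal covariance terms survive; the half is the
share of the noise power in one quadrature. -/
lemma integral_im_sq {R N : ℕ} {M : Fin R → ℕ} {Ω : Type*} [MeasurableSpace Ω]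
    {P : Measure Ω} {W : Ω → Matrix (Idx M) (Fin N) ℂ} {v : ℝ}
    (hW : IsCircularWhiteNoise P W v) (z : Idx M × Fin N → ℂ) :
    ∫ ω, (∑ x, z x * W ω x.1 x.2).im ^ 2 ∂P = v / 2 * ∑ x, ‖z x‖ ^ 2 := by
  have hs : ∀ i n, MemLp (fun ω => star (W ω i n)) 2 P := fun i n => (hW.memLp i n).star
  have hi1 : ∀ x y : Idx M × Fin N,
      Integrable (fun ω => z x * star (z y) * (W ω x.1 x.2 * star (W ω y.1 y.2))) P := by
    intro x y
    exact ((hW.memLp x.1 x.2).integrable_mul (hs y.1 y.2)).const_mul _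
  have hi2 : ∀ x y : Idx M × Fin N,
      Integrable (fun ω => z x * z y * (W ω x.1 x.2 * W ω y.1 y.2)) P := by
    intro x y
    exact ((hW.memLp x.1 x.2).integrable_mul (hW.memLp y.1 y.2)).const_mul _
  have hI : ∀ x y : Idx M × Fin N,
      Integrable (fun ω => z x * star (z y) * (W ω x.1 x.2 * star (W ω y.1 y.2)) -
        z x * z y * (W ω x.1 x.2 * W ω y.1 y.2)) P := fun x y => (hi1 x y).sub (hi2 x y)
  have hexp : ∀ ω, (∑ x, z x * W ω x.1 x.2).im ^ 2 = 1 / 2 *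
      (∑ x, ∑ y, (z x * star (z y) * (W ω x.1 x.2 * star (W ω y.1 y.2)) -
        z x * z y * (W ω x.1 x.2 * W ω y.1 y.2))).re := by
    intro ω
    rw [im_sq_eq, star_sum, Finset.sum_mul_sum, Finset.sum_mul_sum, ← Finset.sum_sub_distrib]
    simp only [← Finset.sum_sub_distrib, star_mul']
    congr 2
    refine Finset.sum_congr rfl fun x _ => Finset.sum_congr rfl fun y _ => ?_
    ring
  simp only [hexp]
  rw [integral_const_mul]
  have hre := integral_re (𝕜 := ℂ) (μ := P) (f := fun ω => ∑ x, ∑ y,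
    (z x * star (z y) * (W ω x.1 x.2 * star (W ω y.1 y.2)) -
        z x * z y * (W ω x.1 x.2 * W ω y.1 y.2)))
    (integrable_finsetSum _ fun x _ => integrable_finsetSum _ fun y _ => hI x y)
  simp only [RCLike.re_to_complex] at hre
  rw [hre, integral_finsetSum _ fun x _ => integrable_finsetSum _ fun y _ => hI x y]
  have hval : ∀ x : Idx M × Fin N, ∫ ω, ∑ y,
      (z x * star (z y) * (W ω x.1 x.2 * star (W ω y.1 y.2)) -
        z x * z y * (W ω x.1 x.2 * W ω y.1 y.2)) ∂P = ((v * ‖z x‖ ^ 2 : ℝ) : ℂ) := by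
    intro x
    rw [integral_finsetSum _ fun y _ => hI x y]
    have : ∀ y, ∫ ω, (z x * star (z y) * (W ω x.1 x.2 * star (W ω y.1 y.2)) -
        z x * z y * (W ω x.1 x.2 * W ω y.1 y.2)) ∂P =
        if x = y then z x * star (z y) * v else 0 := by
      intro y
      rw [integral_sub (hi1 x y) (hi2 x y), integral_const_mul, integral_const_mul,
        hW.covariance, hW.pseudoCovariance]
      simp [Prod.ext_iff]
    simp only [this, Finset.sum_ite_eq, mem_univ, if_true]
    rw [mul_comm (z x), mul_star_self_eq]
    push_cast
    ring
  simp only [hval]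
  rw [← Complex.ofReal_sum, Complex.ofReal_re, ← Finset.mul_sum]
  ring

/-! ## One-dimensional counting -/

/-- The number of ways to write `k` as `a + (o + b)` with `a < n` and `b < L`. -/
noncomputable def shiftCount (n L o k : ℕ) : ℝ :=
  ∑ a : Fin n, ∑ b : Fin L, if k = (a : ℕ) + (o + (b : ℕ)) then 1 else 0

lemma sum_fin_ite_eq_add (L k a : ℕ) :
    (∑ b : Fin L, if k = a + (b : ℕ) then (1 : ℝ) else 0) =
      if a ≤ k ∧ k < a + L then 1 else 0 := by
  rw [Fin.sum_univ_eq_sum_range (fun b => if k = a + b then (1 : ℝ) else 0)]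
  split_ifs with h
  · rw [Finset.sum_eq_single (k - a)]
    · rw [if_pos (by omega)]
    · intro b _ hb
      rw [if_neg (by omega)]
    · intro hb
      simp only [Finset.mem_range] at hb
      omega
  · refine Finset.sum_eq_zero fun b hb => ?_
    simp only [Finset.mem_range] at hb
    rw [if_neg (by omega)]

lemma shiftCount_zero_comm (n L k : ℕ) : shiftCount n L 0 k = shiftCount L n 0 k := by
  unfold shiftCount
  rw [Finset.sum_comm]
  simp only [zero_add]
  simp only [add_comm]

/-- The admissible `a` form the interval from `k + 1 - L` to `min n (k + 1)`; truncated subtraction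
takes care of both ends. -/
lemma shiftCount_zero_eq (n L k : ℕ) :
    shiftCount n L 0 k = ((min n (k + 1) - (k + 1 - L) : ℕ) : ℝ) := by
  unfold shiftCount
  simp only [zero_add, sum_fin_ite_eq_add]
  rw [Fin.sum_univ_eq_sum_range (fun a => if a ≤ k ∧ k < a + L then (1 : ℝ) else 0),
    Finset.sum_boole, ← Nat.card_Ico]
  congr 2
  ext a
  simp only [Finset.mem_filter, Finset.mem_range, Finset.mem_Ico]
  omega

/-- The counts form a trapezoid: a ramp `1, …, L`, a plateau of length `n - L` at height `L`, and a
ramp `L - 1, …, 1`. -/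
lemma sum_shiftCount_sq_of_le {n L : ℕ} (hL : 1 ≤ L) (h : L ≤ n) :
    ∑ k ∈ range (n + L - 1), shiftCount n L 0 k ^ 2 =
      (n : ℝ) * L ^ 2 + (L - (L : ℝ) ^ 3) / 3 := by
  obtain ⟨l, rfl⟩ := Nat.exists_eq_add_of_le' hL
  obtain ⟨d, rfl⟩ := Nat.exists_eq_add_of_le h
  have e : l + 1 + d + (l + 1) - 1 = (l + 1) + d + l := by omega
  rw [e, Finset.sum_range_add, Finset.sum_range_add]
  have h1 : ∑ k ∈ range (l + 1), shiftCount (l + 1 + d) (l + 1) 0 k ^ 2 =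
      ∑ k ∈ range (l + 1), ((k : ℝ) + 1) ^ 2 := by
    refine Finset.sum_congr rfl fun k hk => ?_
    rw [Finset.mem_range] at hk
    rw [shiftCount_zero_eq]
    have : min (l + 1 + d) (k + 1) - (k + 1 - (l + 1)) = k + 1 := by omega
    rw [this]; push_cast; ring
  have h2 : ∑ k ∈ range d, shiftCount (l + 1 + d) (l + 1) 0 (l + 1 + k) ^ 2 =
      ∑ k ∈ range d, ((l : ℝ) + 1) ^ 2 := by
    refine Finset.sum_congr rfl fun k hk => ?_
    rw [Finset.mem_range] at hk
    rw [shiftCount_zero_eq]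
    have : min (l + 1 + d) (l + 1 + k + 1) - (l + 1 + k + 1 - (l + 1)) = l + 1 := by omega
    rw [this]; push_cast; ring
  have h3 : ∑ k ∈ range l, shiftCount (l + 1 + d) (l + 1) 0 (l + 1 + d + k) ^ 2 =
      ∑ k ∈ range l, ((l : ℝ) - k) ^ 2 := by
    refine Finset.sum_congr rfl fun k hk => ?_
    rw [Finset.mem_range] at hk
    rw [shiftCount_zero_eq]
    have : min (l + 1 + d) (l + 1 + d + k + 1) - (l + 1 + d + k + 1 - (l + 1)) = l - k := by omega
    rw [this, Nat.cast_sub hk.le]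
  have h4 : ∀ m : ℕ, ∑ k ∈ range m, ((k : ℝ) + 1) ^ 2 =
      (m : ℝ) * (m + 1) * (2 * m + 1) / 6 := by
    intro m
    induction m with
    | zero => simp
    | succ m ih => rw [Finset.sum_range_succ, ih]; push_cast; ring
  have h5 : ∑ k ∈ range l, ((l : ℝ) - k) ^ 2 = ∑ k ∈ range l, ((k : ℝ) + 1) ^ 2 := by
    rw [← Finset.sum_range_reflect]
    refine Finset.sum_congr rfl fun k hk => ?_
    rw [Finset.mem_range] at hk
    rw [Nat.cast_sub (by omega), Nat.cast_sub (by omega)]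
    push_cast
    ring
  rw [h1, h2, h3, h5, h4, h4, Finset.sum_const, Finset.card_range, nsmul_eq_mul]
  push_cast
  ring

/-- The two branches of the minimum in `cConst` correspond to which of the subarray size and the
number of subarrays is the shorter side of the trapezoid; the count is symmetric in the two. -/
lemma sum_shiftCount_sq {M L : ℕ} (hL : 1 ≤ L) (h : L ≤ M) :
    ∑ k ∈ range M, shiftCount (M - L + 1) L 0 k ^ 2 = cConst M L := by
  obtain ⟨d, rfl⟩ := Nat.exists_eq_add_of_le h
  have e1 : L + d - L + 1 = d + 1 := by omega
  have e2 : ((L + d : ℕ) : ℝ) - L = d := by push_cast; ring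
  rw [e1]
  unfold cConst
  rw [e2]
  rcases le_or_gt L d with hd | hd
  · have := sum_shiftCount_sq_of_le (n := d + 1) hL (by omega)
    have e3 : d + 1 + L - 1 = L + d := by omega
    rw [e3] at this
    rw [this, min_eq_left (by exact_mod_cast hd)]
    push_cast
    ring
  · have := sum_shiftCount_sq_of_le (n := L) (L := d + 1) (by omega) (by omega)
    have e3 : L + (d + 1) - 1 = L + d := by omega
    rw [e3] at this
    simp only [shiftCount_zero_comm (d + 1) L]
    rw [this, min_eq_right (by exact_mod_cast hd.le)]
    push_cast
    ring

lemma cConst_pos {M L : ℕ} (hL : 1 ≤ L) (h : L ≤ M) : 0 < cConst M L := by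
  rw [← sum_shiftCount_sq hL h]
  refine Finset.sum_pos' (fun _ _ => sq_nonneg _) ⟨0, Finset.mem_range.mpr (by omega), ?_⟩
  rw [shiftCount_zero_eq]
  have : min (M - L + 1) (0 + 1) - (0 + 1 - L) = 1 := by omega
  rw [this]
  norm_num

/-- Raising the offset by one is raising `a` by one, so the difference telescopes to its two end
windows of length `L`. -/
lemma shiftCount_one_sub_zero (n L k : ℕ) :
    shiftCount n L 1 k - shiftCount n L 0 k =
      (if n ≤ k ∧ k < n + L then 1 else 0) - (if k < L then 1 else 0) := by
  unfold shiftCount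
  simp only [zero_add, ← add_assoc, sum_fin_ite_eq_add]
  rw [Fin.sum_univ_eq_sum_range (fun a => if a + 1 ≤ k ∧ k < a + 1 + L then (1 : ℝ) else 0),
    Fin.sum_univ_eq_sum_range (fun a => if a ≤ k ∧ k < a + L then (1 : ℝ) else 0),
    ← Finset.sum_sub_distrib,
    Finset.sum_range_sub (fun a => if a ≤ k ∧ k < a + L then (1 : ℝ) else 0)]
  simp

/-- The difference is the indicator of the last `L` positions minus that of the first `L`, so its
square counts their symmetric difference. The windows overlap only when `2 L > M`, whence the
minimum. -/
lemma sum_shiftCount_sub_sq {M L : ℕ} (h : L ≤ M) :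
    ∑ k ∈ range M, (shiftCount (M - L) L 1 k - shiftCount (M - L) L 0 k) ^ 2 =
      2 * min (L : ℝ) (M - L) := by
  have e : ∀ k ∈ range M, (shiftCount (M - L) L 1 k - shiftCount (M - L) L 0 k) ^ 2 =
      (if M - L ≤ k then 1 else 0) + (if k < L then 1 else 0) -
        2 * (if M - L ≤ k ∧ k < L then (1 : ℝ) else 0) := by
    intro k hk
    rw [Finset.mem_range] at hk
    rw [shiftCount_one_sub_zero]
    have : M - L + L = M := by omega
    rw [this]
    by_cases h1 : M - L ≤ k <;> by_cases h2 : k < L <;> simp [h1, h2, hk]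
    norm_num
  rw [Finset.sum_congr rfl e, Finset.sum_sub_distrib, Finset.sum_add_distrib, ← Finset.mul_sum,
    Finset.sum_boole, Finset.sum_boole, Finset.sum_boole]
  have c1 : (range M).filter (fun k => M - L ≤ k) = Finset.Ico (M - L) M := by
    ext k; simp only [Finset.mem_filter, Finset.mem_range, Finset.mem_Ico]; omega
  have c2 : (range M).filter (fun k => k < L) = range L := by
    ext k; simp only [Finset.mem_filter, Finset.mem_range]; omega
  have c3 : (range M).filter (fun k => M - L ≤ k ∧ k < L) = Finset.Ico (M - L) L := by
    ext k; simp only [Finset.mem_filter, Finset.mem_range, Finset.mem_Ico]; omega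
  rw [c1, c2, c3, Nat.card_Ico, Nat.card_Ico, Finset.card_range]
  obtain ⟨d, rfl⟩ := Nat.exists_eq_add_of_le h
  have e2 : ((L + d : ℕ) : ℝ) - L = d := by push_cast; ring
  have e3 : L + d - (L + d - L) = L := by omega
  have e4 : L + d - L = d := by omega
  rw [e2, e3, e4]
  rcases le_total L d with hd | hd
  · rw [min_eq_left (by exact_mod_cast hd), Nat.sub_eq_zero_of_le hd]
    simp; ring
  · rw [min_eq_right (by exact_mod_cast hd), Nat.cast_sub hd]
    ring

/-! ## Selection of blocks of a grid -/

variable {R N : ℕ}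

/-- The position `i + o` in a grid that contains the block of shape `m'` with offset `o`. -/
def offIdx {m' m o : Fin R → ℕ} (h : ∀ p, m' p + o p ≤ m p) (i : Idx m') : Idx m :=
  fun p => ⟨i p + o p, by have := (i p).isLt; have := h p; omega⟩

lemma selMatrix_apply (m' m o : Fin R → ℕ) (i : Idx m') (j : Idx m) :
    selMatrix m' m o i j = if ∀ p, (j p : ℕ) = (i p : ℕ) + o p then 1 else 0 := by
  unfold selMatrix
  rw [Finset.prod_boole]
  simp

lemma selMatrix_mul_apply {m' m o : Fin R → ℕ} (h : ∀ p, m' p + o p ≤ m p) {K : Type*}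
    (Y : Matrix (Idx m) K ℂ) (i : Idx m') (c : K) :
    (selMatrix m' m o * Y) i c = Y (offIdx h i) c := by
  rw [Matrix.mul_apply, Finset.sum_eq_single (offIdx h i)]
  · rw [selMatrix_apply, if_pos (by simp [offIdx]), one_mul]
  · intro j _ hj
    rw [selMatrix_apply, if_neg, zero_mul]
    intro hp
    exact hj (funext fun p => Fin.ext (hp p))
  · intro hj
    exact absurd (mem_univ _) hj

lemma subSize_add_le {M L : Fin R → ℕ} (hLM : ∀ p, L p ≤ M p) (ℓ : Idx L) (p : Fin R) :
    subSize M L p + (ℓ p : ℕ) ≤ M p := by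
  have := (ℓ p).isLt
  have := hLM p
  unfold subSize
  omega

lemma smooth_apply {M L : Fin R → ℕ} (hLM : ∀ p, L p ≤ M p) (X : Matrix (Idx M) (Fin N) ℂ)
    (i : Idx (subSize M L)) (c : Idx L × Fin N) :
    smooth M L X i c = X (offIdx (subSize_add_le hLM c.1) i) c.2 := by
  unfold smooth
  rw [selMatrix_mul_apply (subSize_add_le hLM c.1)]

lemma shiftSize_self (r : Fin R) (m : Fin R → ℕ) : shiftSize r m r = m r - 1 := by
  simp [shiftSize]

lemma shiftSize_of_ne {r p : Fin R} (h : p ≠ r) (m : Fin R → ℕ) : shiftSize r m p = m p := by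
  simp [shiftSize, h]

lemma shiftSize_add_zero_le (r : Fin R) (m : Fin R → ℕ) (p : Fin R) :
    shiftSize r m p + (0 : Fin R → ℕ) p ≤ m p := by
  rcases eq_or_ne p r with rfl | h
  · rw [shiftSize_self]; simp
  · rw [shiftSize_of_ne h]; simp

lemma shiftSize_add_single_le {r : Fin R} {m : Fin R → ℕ} (hm : 1 ≤ m r) (p : Fin R) :
    shiftSize r m p + (Pi.single r 1 : Fin R → ℕ) p ≤ m p := by
  rcases eq_or_ne p r with rfl | h
  · rw [shiftSize_self]; simp; omega
  · rw [shiftSize_of_ne h]; simp [h]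

/-- Reversal of all coordinates, as an equivalence. -/
def revEquiv (m : Fin R → ℕ) : Idx m ≃ Idx m where
  toFun := revIdx
  invFun := revIdx
  left_inv i := by funext p; simp [revIdx]
  right_inv i := by funext p; simp [revIdx]

lemma revIdx_revIdx {m : Fin R → ℕ} (i : Idx m) : revIdx (revIdx i) = i := by
  funext p
  simp [revIdx]

lemma shiftFst_revIdx {r : Fin R} {m : Fin R → ℕ} (hm : 1 ≤ m r) (i : Idx (shiftSize r m))
    (j : Idx m) : shiftFst r m (revIdx i) (revIdx j) = shiftSnd r m i j := by
  unfold shiftFst shiftSnd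
  rw [selMatrix_apply, selMatrix_apply]
  refine if_congr (forall_congr' fun p => ?_) rfl rfl
  have h1 := (i p).isLt
  have h2 := (j p).isLt
  simp only [revIdx, Fin.val_rev, Pi.zero_apply]
  rcases eq_or_ne p r with rfl | h
  · have := shiftSize_self p m
    simp only [Pi.single_eq_same]
    omega
  · have := shiftSize_of_ne h m
    simp only [Pi.single_eq_of_ne h]
    omega

lemma isReversalPair_shift {r : Fin R} {m : Fin R → ℕ} (hm : 1 ≤ m r) :
    IsReversalPair (shiftFst r m) (shiftSnd r m) (revEquiv (shiftSize r m)) (revEquiv m) where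
  star_fst i j := by unfold shiftFst; rw [selMatrix_apply]; split_ifs <;> simp
  star_snd i j := by unfold shiftSnd; rw [selMatrix_apply]; split_ifs <;> simp
  fst i j := shiftFst_revIdx hm i j
  snd i j := by
    have := shiftFst_revIdx hm (revIdx i) (revIdx j)
    rw [revIdx_revIdx, revIdx_revIdx] at this
    exact this.symm
  invol_rows := revIdx_revIdx
  invol := revIdx_revIdx

/-- Reversal of the subarray index in the columns of smoothed data. -/
def revSubarray (L : Fin R → ℕ) (N : ℕ) : Idx L × Fin N ≃ Idx L × Fin N :=
  (revEquiv L).prodCongr (Equiv.refl _)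

/-- Block `ℓ` of the reversed array is the reversal of the block with the opposite offset. Snapshots
keep their order here, so only the subarray part of the column index is reversed. -/
lemma smooth_flipConj {M L : Fin R → ℕ} (hLM : ∀ p, L p ≤ M p) (X : Matrix (Idx M) (Fin N) ℂ) :
    smooth M L (flipConj X) =
      conjReindex (revEquiv (subSize M L)) (revSubarray L N) (smooth M L X) := by
  ext i c
  rw [smooth_apply hLM, conjReindex, smooth_apply hLM]
  unfold flipConj
  have : revIdx (offIdx (subSize_add_le hLM c.1) i) =
      offIdx (subSize_add_le hLM (revSubarray L N c).1) (revEquiv (subSize M L) i) := by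
    funext p
    refine Fin.ext ?_
    have h1 := (i p).isLt
    have h2 := (c.1 p).isLt
    have h3 := hLM p
    simp only [revSubarray, revEquiv, offIdx, revIdx, Fin.val_rev, Equiv.prodCongr_apply,
      Prod.map_fst, Equiv.coe_fn_mk]
    unfold subSize at h1 ⊢
    omega
  rw [this]
  rfl

/-! ## Steering vectors -/

/-- The plane wave `exp (i ∑ₚ (iₚ + cₚ) μₚ)` on a grid. -/
noncomputable def wave {m : Fin R → ℕ} (μ c : Fin R → ℝ) (i : Idx m) : ℂ :=
  Complex.exp (Complex.I * ((∑ p, (((i p : ℕ) : ℝ) + c p) * μ p : ℝ) : ℂ))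

lemma wave_ne_zero {m : Fin R → ℕ} (μ c : Fin R → ℝ) (i : Idx m) : wave μ c i ≠ 0 :=
  Complex.exp_ne_zero _

lemma norm_wave {m : Fin R → ℕ} (μ c : Fin R → ℝ) (i : Idx m) : ‖wave μ c i‖ = 1 := by
  unfold wave
  rw [mul_comm, Complex.norm_exp_ofReal_mul_I]

lemma steering_eq_wave (M : Fin R → ℕ) (μ δ : Fin R → ℝ) (i : Idx M) :
    steering M μ δ i = wave μ (fun p => δ p - ((M p : ℝ) - 1) / 2) i := by
  unfold steering wave
  rw [← Complex.exp_sum, ← Finset.mul_sum, ← Complex.ofReal_sum]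
  congr 3
  refine Finset.sum_congr rfl fun p _ => ?_
  ring

/-- The coordinates of a position and of its reversal have a constant sum, so conjugation restores
the wave up to a fixed phase. -/
lemma wave_revIdx {m : Fin R → ℕ} (μ c : Fin R → ℝ) :
    ∃ κ : ℂ, star κ * κ = 1 ∧ ∀ i : Idx m, star (wave μ c (revIdx i)) = κ * wave μ c i := by
  refine ⟨Complex.exp (Complex.I * ((-∑ p, ((m p : ℝ) - 1 + 2 * c p) * μ p : ℝ) : ℂ)), ?_, ?_⟩
  · rw [mul_star_self_eq, mul_comm Complex.I, Complex.norm_exp_ofReal_mul_I]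
    simp
  · intro i
    unfold wave
    rw [Complex.star_def, ← Complex.exp_conj, ← Complex.exp_add, map_mul, Complex.conj_I,
      Complex.conj_ofReal, ← mul_add, ← Complex.ofReal_add, neg_mul, ← mul_neg,
      ← Complex.ofReal_neg]
    congr 3
    rw [← Finset.sum_neg_distrib, ← Finset.sum_neg_distrib, ← Finset.sum_add_distrib]
    refine Finset.sum_congr rfl fun p _ => ?_
    have : ((revIdx i p : ℕ) : ℝ) = m p - 1 - (i p : ℕ) := by
      have := (i p).isLt
      simp only [revIdx, Fin.val_rev]
      rw [Nat.cast_sub (by omega)]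
      push_cast
      ring
    rw [this]
    ring

lemma wave_offIdx {m' m o : Fin R → ℕ} (h : ∀ p, m' p + o p ≤ m p) (μ c : Fin R → ℝ)
    (i : Idx m') :
    wave μ c (offIdx h i) =
      Complex.exp (Complex.I * ((∑ p, (o p : ℝ) * μ p : ℝ) : ℂ)) * wave μ c i := by
  unfold wave
  rw [← Complex.exp_add, ← mul_add, ← Complex.ofReal_add, ← Finset.sum_add_distrib]
  congr 3
  refine Finset.sum_congr rfl fun p _ => ?_
  simp only [offIdx]
  push_cast
  ring

/-- The steering vector of the subarrays, up to a phase. -/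
noncomputable def subWave (M L : Fin R → ℕ) (μ : Fin R → ℝ) : Idx (subSize M L) → ℂ :=
  wave μ 0

/-- The symbols received by the subarrays. -/
noncomputable def subSymbols (M L : Fin R → ℕ) (μ δ : Fin R → ℝ) (s : Fin N → ℂ) :
    Idx L × Fin N → ℂ :=
  fun c => wave μ (fun p => δ p - ((M p : ℝ) - 1) / 2) c.1 * s c.2

lemma smooth_signal {M L : Fin R → ℕ} (hLM : ∀ p, L p ≤ M p) (μ δ : Fin R → ℝ) (s : Fin N → ℂ) :
    smooth M L (signal M μ δ s) = vecMulVec (subWave M L μ) (subSymbols M L μ δ s) := by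
  ext i c
  rw [smooth_apply hLM, signal, vecMulVec_apply, vecMulVec_apply, steering_eq_wave, subSymbols,
    subWave, ← mul_assoc]
  congr 1
  unfold wave
  rw [← Complex.exp_add, ← mul_add, ← Complex.ofReal_add, ← Finset.sum_add_distrib]
  congr 3
  refine Finset.sum_congr rfl fun p _ => ?_
  simp only [offIdx, Pi.zero_apply]
  push_cast
  ring

lemma subWave_ne_zero {M L : Fin R → ℕ} (μ : Fin R → ℝ) : subWave M L μ ≠ 0 := by
  intro h
  have := congrFun h (fun p => ⟨0, by unfold subSize; omega⟩)
  exact wave_ne_zero _ _ _ this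

lemma subSymbols_ne_zero {M L : Fin R → ℕ} (hL1 : ∀ p, 1 ≤ L p) (μ δ : Fin R → ℝ)
    {s : Fin N → ℂ} (hs : s ≠ 0) : subSymbols M L μ δ s ≠ 0 := by
  obtain ⟨n, hn⟩ := Function.ne_iff.mp hs
  intro h
  have := congrFun h ((fun p => ⟨0, hL1 p⟩), n)
  exact mul_ne_zero (wave_ne_zero _ _ _) hn this

lemma shiftSnd_mul_smooth_signal {M L : Fin R → ℕ} {r : Fin R} (hLM : ∀ p, L p ≤ M p)
    (μ δ : Fin R → ℝ) (s : Fin N → ℂ) :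
    shiftSnd r (subSize M L) * smooth M L (signal M μ δ s) =
      Complex.exp (Complex.I * μ r) •
        (shiftFst r (subSize M L) * smooth M L (signal M μ δ s)) := by
  have hm : 1 ≤ subSize M L r := by unfold subSize; omega
  ext i c
  unfold shiftSnd shiftFst
  rw [Matrix.smul_apply, selMatrix_mul_apply (shiftSize_add_single_le hm),
    selMatrix_mul_apply (shiftSize_add_zero_le r _), smooth_signal hLM, vecMulVec_apply,
    vecMulVec_apply, subWave, wave_offIdx, wave_offIdx, smul_eq_mul]
  simp [Pi.single_apply, mul_assoc]

/-! ## The error of the standard algorithm as a weighted sum of the noise -/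

/-- Weight of the noise at position `k` in the error of the frequency of mode `r`. -/
noncomputable def noiseWeight (r : Fin R) (M L : Fin R → ℕ) (k : Idx M) : ℝ :=
  ∏ p, shiftCount (shiftSize r (subSize M L) p) (L p) ((Pi.single r 1 : Fin R → ℕ) p) (k p) -
    ∏ p, shiftCount (shiftSize r (subSize M L) p) (L p) 0 (k p)

/-- Groups the pairs by the sensor they hit; the number of pairs at a sensor is a product over the
modes because the coordinates are independent. -/
lemma sum_sum_eq_sum_prod_shiftCount {m' L M o : Fin R → ℕ} (f : Idx M → ℂ)
    (κ : Idx m' → Idx L → Idx M)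
    (hκ : ∀ i ℓ p, (κ i ℓ p : ℕ) = (i p : ℕ) + (o p + (ℓ p : ℕ))) :
    ∑ i, ∑ ℓ, f (κ i ℓ) =
      ∑ k : Idx M, ((∏ p, shiftCount (m' p) (L p) (o p) (k p) : ℝ) : ℂ) * f k := by
  have h : ∀ k : Idx M, ∏ p, shiftCount (m' p) (L p) (o p) (k p) =
      ∑ i, ∑ ℓ, if k = κ i ℓ then 1 else 0 := by
    intro k
    unfold shiftCount
    rw [Fintype.prod_sum]
    refine Finset.sum_congr rfl fun i _ => ?_
    rw [Fintype.prod_sum]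
    refine Finset.sum_congr rfl fun ℓ _ => ?_
    rw [Finset.prod_boole]
    simp only [← hκ, funext_iff, Fin.ext_iff, mem_univ, true_imp_iff]
  simp only [h]
  push_cast
  simp only [Finset.sum_mul]
  symm
  rw [Finset.sum_comm]
  refine Finset.sum_congr rfl fun i _ => ?_
  rw [Finset.sum_comm]
  refine Finset.sum_congr rfl fun ℓ _ => ?_
  rw [Finset.sum_eq_single (κ i ℓ)]
  · rw [if_pos rfl, Complex.ofReal_one, one_mul]
  · intro k _ hk
    rw [if_neg hk, Complex.ofReal_zero, zero_mul]
  · intro hk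
    exact absurd (mem_univ _) hk

lemma crossTerm_smooth_signal {M L : Fin R → ℕ} {r : Fin R} (hLM : ∀ p, L p ≤ M p)
    (μ δ : Fin R → ℝ) (s : Fin N → ℂ) (W : Matrix (Idx M) (Fin N) ℂ) :
    crossTerm (shiftFst r (subSize M L)) (shiftSnd r (subSize M L)) (μ r)
        (smooth M L (signal M μ δ s)) (smooth M L W) =
      ∑ x : Idx M × Fin N,
        (noiseWeight r M L x.1 * star (signal M μ δ s x.1 x.2)) * W x.1 x.2 := by
  have hm : 1 ≤ subSize M L r := by unfold subSize; omega
  have hcs : (Complex.exp (Complex.I * μ r))⁻¹ = star (Complex.exp (Complex.I * μ r)) := by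
    rw [Complex.star_def, ← Complex.exp_conj, ← Complex.exp_neg]
    simp
  set X := signal M μ δ s with hX
  set f : Idx M → ℂ := fun k => ∑ n, star (X k n) * W k n with hf
  -- Absorbing `1 / λ` into the conjugated signal turns `J₁ X` into `J₂ X`. In each product signal
  -- and noise are then sampled at the same sensor, as the grouping requires.
  have h1 : ∀ (i : Idx (shiftSize r (subSize M L))) (c : Idx L × Fin N),
      star ((shiftFst r (subSize M L) * smooth M L X) i c) *
        ((Complex.exp (Complex.I * μ r))⁻¹ * (shiftSnd r (subSize M L) * smooth M L W) i c -
          (shiftFst r (subSize M L) * smooth M L W) i c) =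
      star ((shiftSnd r (subSize M L) * smooth M L X) i c) *
          (shiftSnd r (subSize M L) * smooth M L W) i c -
        star ((shiftFst r (subSize M L) * smooth M L X) i c) *
          (shiftFst r (subSize M L) * smooth M L W) i c := by
    intro i c
    rw [hX, shiftSnd_mul_smooth_signal hLM, Matrix.smul_apply, smul_eq_mul, star_mul', hcs]
    ring
  unfold crossTerm
  simp only [h1]
  unfold shiftSnd shiftFst
  simp only [selMatrix_mul_apply (shiftSize_add_single_le hm),
    selMatrix_mul_apply (shiftSize_add_zero_le r _), smooth_apply hLM,
    Fintype.sum_prod_type, Finset.sum_sub_distrib]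
  rw [sum_sum_eq_sum_prod_shiftCount f
      (fun i ℓ => offIdx (subSize_add_le hLM ℓ) (offIdx (shiftSize_add_single_le hm) i))
      (o := Pi.single r 1) (fun i ℓ p => by simp [offIdx, add_assoc]),
    sum_sum_eq_sum_prod_shiftCount f
      (fun i ℓ => offIdx (subSize_add_le hLM ℓ) (offIdx (shiftSize_add_zero_le r _) i))
      (o := 0) (fun i ℓ p => by simp [offIdx]), ← Finset.sum_sub_distrib]
  refine Finset.sum_congr rfl fun k _ => ?_
  rw [← sub_mul, ← Complex.ofReal_sub, hf, Finset.mul_sum]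
  refine Finset.sum_congr rfl fun n _ => ?_
  rw [← mul_assoc]
  rfl

lemma norm_signal (M : Fin R → ℕ) (μ δ : Fin R → ℝ) (s : Fin N → ℂ) (k : Idx M) (n : Fin N) :
    ‖signal M μ δ s k n‖ = ‖s n‖ := by
  rw [signal, vecMulVec_apply, steering_eq_wave, norm_mul, norm_wave, one_mul]

lemma shiftPower_smooth_signal {M L : Fin R → ℕ} {r : Fin R} (hLM : ∀ p, L p ≤ M p)
    (μ δ : Fin R → ℝ) (s : Fin N → ℂ) :
    shiftPower (shiftFst r (subSize M L)) (smooth M L (signal M μ δ s)) =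
      (∏ p, (shiftSize r (subSize M L) p : ℝ)) * (∏ p, (L p : ℝ)) * ∑ n, ‖s n‖ ^ 2 := by
  unfold shiftPower shiftFst
  simp only [selMatrix_mul_apply (shiftSize_add_zero_le r _), smooth_apply hLM, norm_signal,
    Fintype.sum_prod_type, Finset.sum_const, nsmul_eq_mul, Finset.card_univ, Fintype.card_pi,
    Fintype.card_fin]
  push_cast
  ring

lemma noiseWeight_eq (r : Fin R) (M L : Fin R → ℕ) (k : Idx M) :
    noiseWeight r M L k =
      (shiftCount (M r - L r) (L r) 1 (k r) - shiftCount (M r - L r) (L r) 0 (k r)) *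
        ∏ p ∈ univ.erase r, shiftCount (M p - L p + 1) (L p) 0 (k p) := by
  unfold noiseWeight
  rw [← Finset.mul_prod_erase univ _ (mem_univ r), ← Finset.mul_prod_erase univ _ (mem_univ r),
    sub_mul]
  have e : M r - L r + 1 - 1 = M r - L r := by omega
  congr 1
  · simp only [shiftSize_self, subSize, Pi.single_eq_same, e]
    congr 1
    refine Finset.prod_congr rfl fun p hp => ?_
    have hp' := Finset.ne_of_mem_erase hp
    rw [shiftSize_of_ne hp', Pi.single_eq_of_ne hp', subSize]
  · simp only [shiftSize_self, subSize, e]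
    congr 1
    refine Finset.prod_congr rfl fun p hp => ?_
    have hp' := Finset.ne_of_mem_erase hp
    rw [shiftSize_of_ne hp', subSize]

lemma sum_noiseWeight_sq {r : Fin R} {M L : Fin R → ℕ} (hLM : ∀ p, L p ≤ M p)
    (hL1 : ∀ p, 1 ≤ L p) :
    ∑ k : Idx M, noiseWeight r M L k ^ 2 =
      2 * min (L r : ℝ) (M r - L r) * ∏ p ∈ univ.erase r, cConst (M p) (L p) := by
  let h : (p : Fin R) → Fin (M p) → ℝ := fun p k =>
    if p = r then (shiftCount (M p - L p) (L p) 1 k - shiftCount (M p - L p) (L p) 0 k) ^ 2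
    else shiftCount (M p - L p + 1) (L p) 0 k ^ 2
  have e1 : ∀ k : Idx M, noiseWeight r M L k ^ 2 = ∏ p, h p (k p) := by
    intro k
    rw [noiseWeight_eq, mul_pow, ← Finset.prod_pow, ← Finset.mul_prod_erase univ _ (mem_univ r)]
    simp only [h, if_true]
    congr 1
    refine Finset.prod_congr rfl fun p hp => ?_
    rw [if_neg (Finset.ne_of_mem_erase hp)]
  simp only [e1]
  rw [← Fintype.prod_sum, ← Finset.mul_prod_erase univ _ (mem_univ r)]
  congr 1
  · simp only [h, if_true]
    rw [Fin.sum_univ_eq_sum_range (fun k => (shiftCount (M r - L r) (L r) 1 k -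
      shiftCount (M r - L r) (L r) 0 k) ^ 2), sum_shiftCount_sub_sq (hLM r)]
  · refine Finset.prod_congr rfl fun p hp => ?_
    simp only [h, if_neg (Finset.ne_of_mem_erase hp)]
    rw [Fin.sum_univ_eq_sum_range (fun k => shiftCount (M p - L p + 1) (L p) 0 k ^ 2),
      sum_shiftCount_sq (hL1 p) (hLM p)]

/-- The `2` from mode `r` cancels the half of the noise variance, and one power of the signal energy
cancels against the squared `shiftPower`. -/
lemma integral_sq_standard {r : Fin R} {M L : Fin R → ℕ} (hLM : ∀ p, L p ≤ M p)
    (hL1 : ∀ p, 1 ≤ L p) (hLr : L r < M r) (μ δ : Fin R → ℝ) {s : Fin N → ℂ} (hs : s ≠ 0)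
    {Ω : Type*} [MeasurableSpace Ω] {P : Measure Ω}
    {W : Ω → Matrix (Idx M) (Fin N) ℂ} {v : ℝ} (hW : IsCircularWhiteNoise P W v) :
    ∫ ω, ((crossTerm (shiftFst r (subSize M L)) (shiftSnd r (subSize M L)) (μ r)
        (smooth M L (signal M μ δ s)) (smooth M L (W ω))).im /
        shiftPower (shiftFst r (subSize M L)) (smooth M L (signal M μ δ s))) ^ 2 ∂P =
      1 / effectiveSNR s v * aConst r M L *
        (min (L r : ℝ) (M r - L r) / (((M r : ℝ) - L r) ^ 2 * (L r : ℝ) ^ 2)) := by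
  simp only [crossTerm_smooth_signal hLM, div_pow]
  rw [integral_div, integral_im_sq hW]
  have e : ∑ x : Idx M × Fin N,
      ‖(noiseWeight r M L x.1 : ℂ) * star (signal M μ δ s x.1 x.2)‖ ^ 2 =
      (∑ k : Idx M, noiseWeight r M L k ^ 2) * ∑ n, ‖s n‖ ^ 2 := by
    rw [Fintype.sum_prod_type, Finset.sum_mul_sum]
    refine Finset.sum_congr rfl fun k _ => Finset.sum_congr rfl fun n _ => ?_
    rw [norm_mul, norm_star, norm_signal, mul_pow, Complex.norm_real, Real.norm_eq_abs, sq_abs]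
  rw [e, sum_noiseWeight_sq hLM hL1, shiftPower_smooth_signal hLM]
  have hS : 0 < ∑ n, ‖s n‖ ^ 2 := sum_norm_sq_pos hs
  have hN : (N : ℝ) ≠ 0 := by
    rintro h
    have h0 : N = 0 := by exact_mod_cast h
    subst h0
    exact hs (Subsingleton.elim _ _)
  unfold effectiveSNR aConst
  set S := ∑ n, ‖s n‖ ^ 2 with hSd
  rw [← Finset.mul_prod_erase univ (fun p => (shiftSize r (subSize M L) p : ℝ)) (mem_univ r),
    ← Finset.mul_prod_erase univ (fun p => (L p : ℝ)) (mem_univ r), shiftSize_self]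
  have e2 : ((subSize M L r - 1 : ℕ) : ℝ) = M r - L r := by
    unfold subSize
    rw [Nat.add_sub_cancel, Nat.cast_sub (hLM r)]
  have e3 : ∏ p ∈ univ.erase r, (shiftSize r (subSize M L) p : ℝ) =
      ∏ p ∈ univ.erase r, ((M p : ℝ) - L p + 1) := by
    refine Finset.prod_congr rfl fun p hp => ?_
    rw [shiftSize_of_ne (Finset.ne_of_mem_erase hp)]
    unfold subSize
    push_cast [Nat.cast_sub (hLM p)]
    rfl
  rw [e2, e3, Finset.prod_div_distrib, Finset.prod_mul_distrib, Finset.prod_pow, Finset.prod_pow]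
  have h1 : (L r : ℝ) ≠ 0 := by have := hL1 r; positivity
  have h2 : (M r : ℝ) - L r ≠ 0 := by
    have : (L r : ℝ) < M r := by exact_mod_cast hLr
    linarith
  have h3 : ∏ p ∈ univ.erase r, (L p : ℝ) ≠ 0 := by
    refine Finset.prod_ne_zero_iff.mpr fun p _ => ?_
    have := hL1 p
    positivity
  have h4 : ∏ p ∈ univ.erase r, ((M p : ℝ) - L p + 1) ≠ 0 := by
    refine Finset.prod_ne_zero_iff.mpr fun p _ => ?_
    have : (L p : ℝ) ≤ M p := by exact_mod_cast hLM p
    linarith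
  have h5 : S ≠ 0 := hS.ne'
  have e4 : (N : ℝ) * (S / N) / v = S / v := by field_simp
  rw [e4]
  -- The minimum enters linearly on both sides, so its value is irrelevant.
  generalize min (L r : ℝ) (M r - L r) = q
  field_simp

/-! ## Rank one of the preprocessed data -/

section RankOne

variable {I K : Type*}

lemma fromCols_conjReindex_vecMulVec {x : I → ℂ} {κ : ℂ} {π : I → I}
    (hx : ∀ i, star (x (π i)) = κ * x i) (πK : K → K) (y : K → ℂ) :
    fromCols (vecMulVec x y) (conjReindex π πK (vecMulVec x y)) =
      vecMulVec x (Sum.elim y (fun k => κ * star (y (πK k)))) := by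
  ext i (k | k)
  · simp [vecMulVec_apply]
  · rw [fromCols_apply_inr, conjReindex, vecMulVec_apply, vecMulVec_apply, star_mul', hx,
      Sum.elim_inr]
    ring

/-- Stacking rows keeps rank one only if the row factor `y` is also conjugate-symmetric up to a
scalar. This is where strict non-circularity is needed. -/
lemma fromRows_conjReindex_vecMulVec {x : I → ℂ} {y : K → ℂ} {κ κ' : ℂ} {π : I → I} {πK : K → K}
    (hx : ∀ i, star (x (π i)) = κ * x i) (hy : ∀ k, star (y (πK k)) = κ' * y k) :
    fromRows (vecMulVec x y) (conjReindex π πK (vecMulVec x y)) =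
      vecMulVec (Sum.elim x (fun i => κ * κ' * x i)) y := by
  ext (i | i) k
  · simp [vecMulVec_apply]
  · rw [fromRows_apply_inr, conjReindex, vecMulVec_apply, vecMulVec_apply, star_mul', hx, hy,
      Sum.elim_inr]
    ring

lemma sumElim_ne_zero {x : I → ℂ} (hx : x ≠ 0) (y : K → ℂ) : Sum.elim x y ≠ 0 := by
  obtain ⟨i, hi⟩ := Function.ne_iff.mp hx
  exact Function.ne_iff.mpr ⟨Sum.inl i, hi⟩

end RankOne

lemma subWave_revIdx (M L : Fin R → ℕ) (μ : Fin R → ℝ) :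
    ∃ κ : ℂ, star κ * κ = 1 ∧
      ∀ i, star (subWave M L μ (revEquiv (subSize M L) i)) = κ * subWave M L μ i :=
  wave_revIdx μ 0

/-- A common phase gives `conj s = exp (-2 i φ) s`, to be combined with the symmetry of the wave
over the subarrays. -/
lemma subSymbols_revSubarray (M L : Fin R → ℕ) (μ δ : Fin R → ℝ) {s : Fin N → ℂ}
    (hs : ∃ (φ : ℝ) (s₀ : Fin N → ℝ), ∀ n, s n = Complex.exp (Complex.I * φ) * (s₀ n : ℂ)) :
    ∃ κ : ℂ, star κ * κ = 1 ∧
      ∀ c, star (subSymbols M L μ δ s (revSubarray L N c)) = κ * subSymbols M L μ δ s c := by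
  obtain ⟨φ, s₀, h⟩ := hs
  obtain ⟨κ, hκ, hw⟩ := wave_revIdx (m := L) μ (fun p => δ p - ((M p : ℝ) - 1) / 2)
  set e := Complex.exp (Complex.I * φ) with he
  have hee : star e * e = 1 := by
    rw [mul_star_self_eq, he, mul_comm Complex.I, Complex.norm_exp_ofReal_mul_I]
    simp
  refine ⟨κ * (star e * star e), ?_, fun c => ?_⟩
  · simp only [star_mul', star_star]
    linear_combination hκ * (star e * e) ^ 2 + (star e * e + 1) * hee
  · have hsn : star (s c.2) = star e * star e * s c.2 := by
      rw [h, star_mul', Complex.star_def, Complex.conj_ofReal]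
      rw [Complex.star_def] at hee
      linear_combination -((starRingEnd ℂ) e * s₀ c.2) * hee
    have hw' := hw c.1
    unfold subSymbols
    rw [star_mul']
    change star (wave _ _ (revIdx c.1)) * star (s c.2) = _
    rw [hw', hsn]
    ring

/-! ## The mean squared error of all algorithms -/

lemma fba_revCol_eq {I : Type*} (π : I ≃ I) {πI : I → I} (h : ∀ i, πI i = π i) {L : Fin R → ℕ}
    (Y : Matrix I (Idx L × Fin N) ℂ) :
    fba πI revCol Y = fromCols Y (conjReindex π ((revEquiv L).prodCongr Fin.revPerm) Y) := by
  have : πI = π := funext h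
  subst this
  rfl

lemma ncSmooth_ncAugment {M L : Fin R → ℕ} (hLM : ∀ p, L p ≤ M p)
    (X : Matrix (Idx M) (Fin N) ℂ) :
    ncSmooth M L (ncAugment X) = fromRows (smooth M L X)
      (conjReindex (revEquiv (subSize M L)) (revSubarray L N) (smooth M L X)) := by
  unfold ncSmooth ncAugment
  rw [toRows₁_fromRows, toRows₂_fromRows, smooth_flipConj hLM]

theorem mseSS_eq (alg : Algorithm) {r : Fin R} {M L : Fin R → ℕ} (hLM : ∀ p, L p ≤ M p)
    (hL1 : ∀ p, 1 ≤ L p) (hLr : L r < M r) (μ δ : Fin R → ℝ) {s : Fin N → ℂ} (hs : s ≠ 0)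
    {Ω : Type*} [MeasurableSpace Ω] {P : Measure Ω}
    {W : Ω → Matrix (Idx M) (Fin N) ℂ} {v : ℝ} (hW : IsCircularWhiteNoise P W v)
    (hNC : alg.IsNC → ∃ (φ : ℝ) (s₀ : Fin N → ℝ),
      ∀ n, s n = Complex.exp (Complex.I * φ) * (s₀ n : ℂ)) :
    mseSS alg r M L μ δ s P W = 1 / effectiveSNR s v * aConst r M L *
        (min (L r : ℝ) (M r - L r) / (((M r : ℝ) - L r) ^ 2 * (L r : ℝ) ^ 2)) := by
  have hm : 1 ≤ subSize M L r := by unfold subSize; omega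
  have hrev := isReversalPair_shift hm
  have hX := shiftSnd_mul_smooth_signal (r := r) hLM μ δ s
  have hx := subWave_ne_zero (M := M) (L := L) μ
  have hy := subSymbols_ne_zero (M := M) hL1 μ δ hs
  obtain ⟨κ, hκ, hκx⟩ := subWave_revIdx M L μ
  rw [← integral_sq_standard hLM hL1 hLr μ δ hs hW]
  unfold mseSS
  cases alg with
  | standard => exact firstOrderMSE_eq _ _ _ hX hx hy (smooth_signal hLM μ δ s) P _
  | unitary =>
    simp only [fba_revCol_eq (revEquiv (subSize M L)) (πI := revIdx) (fun _ => rfl)]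
    rw [firstOrderMSE_eq _ _ _ (hrev.fromCols_conjReindex _ _ hX 0).1 hx
      (sumElim_ne_zero hy _)
      (by rw [smooth_signal hLM]; exact fromCols_conjReindex_vecMulVec hκx _ _)]
    simp only [(hrev.fromCols_conjReindex _ _ hX _).2]
  | ncStandard =>
    obtain ⟨κ', hκ', hκy⟩ := subSymbols_revSubarray M L μ δ (hNC trivial)
    simp only [ncSmooth_ncAugment hLM]
    rw [firstOrderMSE_eq _ _ _ (hrev.fromRows_conjReindex _ _ hX 0).1
      (sumElim_ne_zero hx _) hy
      (by rw [smooth_signal hLM]; exact fromRows_conjReindex_vecMulVec hκx hκy)]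
    simp only [(hrev.fromRows_conjReindex _ _ hX _).2]
  | ncUnitary =>
    obtain ⟨κ', hκ', hκy⟩ := subSymbols_revSubarray M L μ δ (hNC trivial)
    have hX2 := (hrev.fromRows_conjReindex (revSubarray L N) _ hX 0).1
    have hrank := fromRows_conjReindex_vecMulVec hκx hκy
    rw [← smooth_signal hLM] at hrank
    -- The augmented column is again invariant under reversed conjugation up to a scalar: the block
    -- exchange undoes the factor `κ κ'`, as both are unimodular. Averaging therefore preserves rank
    -- one.
    have hsym : ∀ i, star (Sum.elim (subWave M L μ) (fun i => κ * κ' * subWave M L μ i)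
        (((Equiv.sumCongr (revEquiv (subSize M L)) (revEquiv (subSize M L))).trans
          (Equiv.sumComm _ _)) i)) =
        star κ' * Sum.elim (subWave M L μ) (fun i => κ * κ' * subWave M L μ i) i := by
      rintro (i | i)
      · simp only [Equiv.trans_apply, Equiv.sumCongr_apply, Sum.map_inl, Equiv.sumComm_apply,
          Sum.swap_inl, Sum.elim_inr, Sum.elim_inl, star_mul', hκx]
        linear_combination (star κ' * subWave M L μ i) * hκ
      · simp only [Equiv.trans_apply, Equiv.sumCongr_apply, Sum.map_inr, Equiv.sumComm_apply,
          Sum.swap_inr, Sum.elim_inr, Sum.elim_inl, hκx]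
        linear_combination -(κ * subWave M L μ i) * hκ'
    simp only [ncSmooth_ncAugment hLM]
    simp only [fba_revCol_eq (((Equiv.sumCongr (revEquiv (subSize M L))
      (revEquiv (subSize M L))).trans (Equiv.sumComm _ _))) (πI := revNC)
        (by rintro (i | i) <;> rfl)]
    rw [firstOrderMSE_eq _ _ _ (hrev.twice.fromCols_conjReindex _ _ hX2 0).1
      (sumElim_ne_zero hx _) (sumElim_ne_zero hy _)
      (by rw [hrank]; exact fromCols_conjReindex_vecMulVec hsym _ _)]
    simp only [(hrev.twice.fromCols_conjReindex _ _ hX2 _).2,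
      (hrev.fromRows_conjReindex _ _ hX _).2]

/-! ## Optimization of the number of subarrays -/

lemma cConst_one {m : ℕ} (hm : 1 ≤ m) : cConst m 1 = m := by
  have := sum_shiftCount_sq_of_le (n := m) (L := 1) le_rfl hm
  have h2 := sum_shiftCount_sq (M := m) (L := 1) le_rfl hm
  have e : m - 1 + 1 = m := by omega
  rw [e] at h2
  rw [Nat.add_sub_cancel, h2] at this
  simpa using this

lemma aConst_one (r : Fin R) {M : Fin R → ℕ} (hM : ∀ p, 1 ≤ M p) :
    aConst r M (fun _ => 1) = ∏ p ∈ univ.erase r, (M p : ℝ)⁻¹ := by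
  unfold aConst
  refine Finset.prod_congr rfl fun p _ => ?_
  have h0 : (M p : ℝ) ≠ 0 := by have := hM p; positivity
  rw [Nat.cast_one, cConst_one (hM p), sub_add_cancel]
  field_simp

lemma aConst_update (r : Fin R) (M L : Fin R → ℕ) (l : ℕ) :
    aConst r M (Function.update L r l) = aConst r M L := by
  unfold aConst
  refine Finset.prod_congr rfl fun p hp => ?_
  rw [Function.update_of_ne (Finset.ne_of_mem_erase hp)]

lemma aConst_pos {r : Fin R} {M L : Fin R → ℕ} (hL : ∀ p, p ≠ r → 1 ≤ L p ∧ L p ≤ M p) :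
    0 < aConst r M L := by
  refine Finset.prod_pos fun p hp => ?_
  obtain ⟨h1, h2⟩ := hL p (Finset.ne_of_mem_erase hp)
  have h3 : (L p : ℝ) ≤ M p := by exact_mod_cast h2
  have h4 : 0 < (M p : ℝ) - L p + 1 := by linarith
  have h5 := cConst_pos h1 h2
  have h6 : (0 : ℝ) < L p := by exact_mod_cast h1
  positivity

/-- The dependence of the mean squared error on the number of subarrays. -/
noncomputable def modeFactor (m l : ℕ) : ℝ :=
  min (l : ℝ) (m - l) / (((m : ℝ) - l) ^ 2 * (l : ℝ) ^ 2)

lemma modeFactor_of_two_mul_le {m l : ℕ} (hl : 1 ≤ l) (h : 2 * l ≤ m) :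
    modeFactor m l = 1 / ((l : ℝ) * ((m : ℝ) - l) ^ 2) := by
  have h1 : 2 * (l : ℝ) ≤ m := by exact_mod_cast h
  have h2 : (0 : ℝ) < l := by exact_mod_cast hl
  have h3 : (m : ℝ) - l ≠ 0 := by linarith
  unfold modeFactor
  rw [min_eq_left (by linarith)]
  field_simp

lemma modeFactor_reflect {m l : ℕ} (h : l ≤ m) : modeFactor m (m - l) = modeFactor m l := by
  unfold modeFactor
  rw [Nat.cast_sub h, sub_sub_cancel, min_comm, mul_comm]

lemma Lopt_bounds {m : ℕ} (hm : 2 ≤ m) : 1 ≤ Lopt m ∧ 2 * Lopt m ≤ m := by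
  unfold Lopt
  split_ifs <;> omega

/-- With `k = Lopt m`, the difference of the two scores is divisible by `k - l`. For `m = 3 k` it is
`(k - l)² (4 k - l)`; otherwise `k` is off the real maximizer by `1 / 3`, and on the side of that
maximizer the gap `|k - l| ≥ 1` between integers is essential. -/
lemma score_lt {m l : ℕ} (hl : 1 ≤ l) (h : 2 * l ≤ m) (hne : l ≠ Lopt m) :
    (l : ℝ) * ((m : ℝ) - l) ^ 2 < (Lopt m : ℝ) * ((m : ℝ) - Lopt m) ^ 2 := by
  have hl' : (1 : ℝ) ≤ l := by exact_mod_cast hl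
  have h' : 2 * (l : ℝ) ≤ m := by exact_mod_cast h
  obtain ⟨k, hk⟩ : ∃ k, k = Lopt m := ⟨_, rfl⟩
  rw [← hk] at hne ⊢
  unfold Lopt at hk
  rcases Nat.lt_or_gt_of_ne hne with hlt | hlt
  · have hlt' : (l : ℝ) + 1 ≤ k := by exact_mod_cast hlt
    split_ifs at hk with h0 h1
    · have e : m = 3 * k := by omega
      have e' : (m : ℝ) = 3 * k := by exact_mod_cast e
      rw [e'] at h' ⊢
      have : 0 < ((k : ℝ) - l) ^ 2 * (4 * k - l) := by
        have : 0 < (k : ℝ) - l := by linarith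
        have : 0 < 4 * (k : ℝ) - l := by linarith
        positivity
      nlinarith
    · have e : m = 3 * k + 1 := by omega
      have e' : (m : ℝ) = 3 * k + 1 := by exact_mod_cast e
      rw [e'] at h' ⊢
      have h1 : 0 < (k : ℝ) - l := by linarith
      have h2 : 0 < (3 * (k : ℝ) + 2) * (k - l) + 2 * k + 1 + (k - l) ^ 2 := by
        have : 0 < (3 * (k : ℝ) + 2) * (k - l) := by positivity
        positivity
      linarith [mul_pos h1 h2]
    · have e : m + 1 = 3 * k := by omega
      have e' : (m : ℝ) = 3 * k - 1 := by
        have : (m : ℝ) + 1 = 3 * k := by exact_mod_cast e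
        linarith
      rw [e'] at h' ⊢
      have h1 : 0 < (k : ℝ) - l := by linarith
      have h2 : 0 < (3 * (k : ℝ) - 2) * (k - l) - (2 * k - 1) + (k - l) ^ 2 := by
        nlinarith
      linarith [mul_pos h1 h2]
  · have hlt' : (k : ℝ) + 1 ≤ l := by exact_mod_cast hlt
    have hk0 : (0 : ℝ) ≤ k := by positivity
    split_ifs at hk with h0 h1
    · have e : m = 3 * k := by omega
      have e' : (m : ℝ) = 3 * k := by exact_mod_cast e
      rw [e'] at h' ⊢
      have : 0 < ((k : ℝ) - l) ^ 2 * (4 * k - l) := by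
        have : 0 < (l : ℝ) - k := by linarith
        have : 0 < 4 * (k : ℝ) - l := by linarith
        rw [← neg_sub (l : ℝ), neg_sq]
        positivity
      nlinarith
    · have e : m = 3 * k + 1 := by omega
      have e' : (m : ℝ) = 3 * k + 1 := by exact_mod_cast e
      rw [e'] at h' ⊢
      have h1 : 0 < (l : ℝ) - k := by linarith
      -- The expression is concave in `l - k` and positive at both ends of the range allowed by `l ≥
      -- k + 1` and `2 l ≤ m`.
      have h2 : 0 < (3 * (k : ℝ) + 2) * (l - k) - (2 * k + 1) - (l - k) ^ 2 := by
        nlinarith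
      linarith [mul_pos h1 h2]
    · have e : m + 1 = 3 * k := by omega
      have e' : (m : ℝ) = 3 * k - 1 := by
        have : (m : ℝ) + 1 = 3 * k := by exact_mod_cast e
        linarith
      rw [e'] at h' ⊢
      have h1 : 0 < (l : ℝ) - k := by linarith
      have h2 : 0 < (3 * (k : ℝ) - 2) * (l - k) + (2 * k - 1) - (l - k) ^ 2 := by
        nlinarith
      linarith [mul_pos h1 h2]

/-- For `l` beyond `m / 2` the reflected value `m - l` lies in the range of `score_lt`, which is why
both exceptional values are excluded. -/
lemma modeFactor_Lopt_lt {m l : ℕ} (hm : 2 ≤ m) (hl : 1 ≤ l) (hlm : l ≤ m - 1)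
    (h1 : l ≠ Lopt m) (h2 : l ≠ m - Lopt m) : modeFactor m (Lopt m) < modeFactor m l := by
  have key : ∀ l, 1 ≤ l → 2 * l ≤ m → l ≠ Lopt m →
      modeFactor m (Lopt m) < modeFactor m l := by
    intro l hl h hne
    rw [modeFactor_of_two_mul_le (Lopt_bounds hm).1 (Lopt_bounds hm).2,
      modeFactor_of_two_mul_le hl h]
    refine one_div_lt_one_div_of_lt ?_ (score_lt hl h hne)
    have a1 : (1 : ℝ) ≤ l := by exact_mod_cast hl
    have a2 : 2 * (l : ℝ) ≤ m := by exact_mod_cast h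
    have a3 : 0 < (m : ℝ) - l := by linarith
    positivity
  rcases le_total (2 * l) m with h | h
  · exact key l hl h h1
  · rw [← modeFactor_reflect (show l ≤ m by omega)]
    refine key (m - l) (by omega) (by omega) ?_
    have := (Lopt_bounds hm).2
    omega

lemma setOf_isMinOn_modeFactor {m : ℕ} (hm : 2 ≤ m) {f : ℕ → ℝ} {C : ℝ} (hC : 0 < C)
    (hf : ∀ l ∈ Set.Icc 1 (m - 1), f l = C * modeFactor m l) :
    {l : ℕ | l ∈ Set.Icc 1 (m - 1) ∧ IsMinOn f (Set.Icc 1 (m - 1)) l} =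
      {Lopt m, m - Lopt m} := by
  obtain ⟨b1, b2⟩ := Lopt_bounds hm
  have mem1 : Lopt m ∈ Set.Icc 1 (m - 1) := ⟨b1, by omega⟩
  have mem2 : m - Lopt m ∈ Set.Icc 1 (m - 1) := ⟨by omega, by omega⟩
  have hrefl := modeFactor_reflect (show Lopt m ≤ m by omega)
  have hmin : ∀ l ∈ Set.Icc 1 (m - 1), modeFactor m (Lopt m) ≤ modeFactor m l := by
    intro l hl
    by_cases h1 : l = Lopt m
    · rw [h1]
    by_cases h2 : l = m - Lopt m
    · rw [h2, hrefl]
    exact (modeFactor_Lopt_lt hm hl.1 hl.2 h1 h2).le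
  ext l
  simp only [Set.mem_ofPred_eq, Set.mem_insert_iff, Set.mem_singleton_iff]
  constructor
  · rintro ⟨hl, hl2⟩
    by_contra hcon
    push Not at hcon
    have h1 := modeFactor_Lopt_lt hm hl.1 hl.2 hcon.1 hcon.2
    have h2 := isMinOn_iff.mp hl2 _ mem1
    rw [hf l hl, hf _ mem1] at h2
    exact absurd (le_of_mul_le_mul_left h2 hC) (not_le.mpr h1)
  · rintro (rfl | rfl)
    · refine ⟨mem1, isMinOn_iff.mpr fun l hl => ?_⟩
      rw [hf l hl, hf _ mem1]
      exact mul_le_mul_of_nonneg_left (hmin l hl) hC.le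
    · refine ⟨mem2, isMinOn_iff.mpr fun l hl => ?_⟩
      rw [hf l hl, hf _ mem2, hrefl]
      exact mul_le_mul_of_nonneg_left (hmin l hl) hC.le

lemma gainFormula_eq {m : ℕ} (hm : 2 ≤ m) {t a : ℝ} (ht : t ≠ 0) (ha : a ≠ 0) :
    (m : ℝ) / (t * ((m : ℝ) - 1) ^ 2) / (a * modeFactor m (Lopt m)) = gainFormula m t a := by
  obtain ⟨b1, b2⟩ := Lopt_bounds hm
  rw [modeFactor_of_two_mul_le b1 b2]
  have hm1 : (m : ℝ) - 1 ≠ 0 := by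
    have : (2 : ℝ) ≤ m := by exact_mod_cast hm
    linarith
  unfold gainFormula
  obtain ⟨k, hk⟩ : ∃ k, k = Lopt m := ⟨_, rfl⟩
  rw [← hk]
  unfold Lopt at hk
  split_ifs at hk ⊢ with h0 h1
  · have e : m = 3 * k := by omega
    have e' : (k : ℝ) = m / 3 := by rw [e]; push_cast; ring
    rw [e']
    field_simp
    ring
  · have e : m = 3 * k + 1 := by omega
    have e' : (k : ℝ) = (m - 1) / 3 := by rw [e]; push_cast; ring
    rw [e']
    field_simp
    ring
  · have e : m + 1 = 3 * k := by omega
    have e' : (k : ℝ) = (m + 1) / 3 := by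
      have : (m : ℝ) + 1 = 3 * k := by exact_mod_cast e
      linarith
    rw [e']
    field_simp
    ring

lemma effectiveSNR_pos {s : Fin N → ℂ} (hs : s ≠ 0) {v : ℝ} (hv : 0 < v) :
    0 < effectiveSNR s v := by
  have hS := sum_norm_sq_pos hs
  have hN : (0 : ℝ) < N := by
    obtain ⟨n, _⟩ := Function.ne_iff.mp hs
    exact_mod_cast n.pos
  unfold effectiveSNR
  positivity

end SpatialSmoothing

/-! ### Minimal MSE and maximal gain -/

theorem mainTheorem7 {R N : ℕ} (r : Fin R) (M L : Fin R → ℕ)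
    (hM : ∀ p, 1 ≤ M p) (hMr : 2 ≤ M r)
    (hL : ∀ p, p ≠ r → 1 ≤ L p ∧ L p ≤ M p)
    (μ δ : Fin R → ℝ) (s : Fin N → ℂ) (hs : s ≠ 0)
    {Ω : Type*} [MeasurableSpace Ω] (P : Measure Ω) [IsProbabilityMeasure P]
    (W : Ω → Matrix (SpatialSmoothing.Idx M) (Fin N) ℂ) (v : ℝ) (hv : 0 < v)
    (hW : SpatialSmoothing.IsCircularWhiteNoise P W v)
    (alg : SpatialSmoothing.Algorithm)
    (hNC : alg.IsNC → ∃ (φ : ℝ) (s₀ : Fin N → ℝ),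
      ∀ n, s n = Complex.exp (Complex.I * φ) * (s₀ n : ℂ)) :
    -- the MSE without spatial smoothing
    SpatialSmoothing.mseNoSS alg r M μ δ s P W =
        1 / SpatialSmoothing.effectiveSNR s v *
          ((M r : ℝ) / ((∏ p, (M p : ℝ)) * ((M r : ℝ) - 1) ^ 2)) ∧
      -- the numbers of subarrays in mode `r` that minimize the MSE
      {l : ℕ | l ∈ Set.Icc 1 (M r - 1) ∧
          IsMinOn (fun l' : ℕ =>
            SpatialSmoothing.mseSS alg r M (Function.update L r l') μ δ s P W)
            (Set.Icc 1 (M r - 1)) l} =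
        {SpatialSmoothing.Lopt (M r), M r - SpatialSmoothing.Lopt (M r)} ∧
      -- the gain at these numbers
      ∀ l ∈ ({SpatialSmoothing.Lopt (M r), M r - SpatialSmoothing.Lopt (M r)} : Set ℕ),
        SpatialSmoothing.mseNoSS alg r M μ δ s P W /
            SpatialSmoothing.mseSS alg r M (Function.update L r l) μ δ s P W =
          SpatialSmoothing.gainFormula (M r) (∏ p, (M p : ℝ))
            (SpatialSmoothing.aConst r M L) := by
  open SpatialSmoothing in
  have hρ := effectiveSNR_pos hs hv
  have ha := aConst_pos hL
  have hMr' : (2 : ℝ) ≤ M r := by exact_mod_cast hMr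
  have hM0 : ∀ p, (M p : ℝ) ≠ 0 := fun p => by have := hM p; positivity
  have hprod : ∏ p, (M p : ℝ) ≠ 0 := Finset.prod_ne_zero_iff.mpr fun p _ => hM0 p
  have hno : mseNoSS alg r M μ δ s P W = 1 / effectiveSNR s v *
      ((M r : ℝ) / ((∏ p, (M p : ℝ)) * ((M r : ℝ) - 1) ^ 2)) := by
    unfold mseNoSS
    -- A single subarray per mode is the case `L = 1`, where each other mode contributes `1 / M p`
    -- and the minimum is `1` because `2 ≤ M r`.
    rw [mseSS_eq alg hM (fun _ => le_rfl) (by omega) μ δ hs hW hNC, aConst_one r hM,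
      ← Finset.mul_prod_erase univ (fun p => (M p : ℝ)) (mem_univ r), Finset.prod_inv_distrib,
      Nat.cast_one, min_eq_left (by linarith)]
    have h1 : ∏ p ∈ univ.erase r, (M p : ℝ) ≠ 0 := Finset.prod_ne_zero_iff.mpr fun p _ => hM0 p
    have h2 : (M r : ℝ) - 1 ≠ 0 := by linarith
    have h3 := hM0 r
    field_simp
  have hss : ∀ l ∈ Set.Icc 1 (M r - 1), mseSS alg r M (Function.update L r l) μ δ s P W =
      1 / effectiveSNR s v * aConst r M L * modeFactor (M r) l := by
    intro l hl
    have hl1 := hl.1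
    have hl2 := hl.2
    -- The given `L r` is unconstrained; the update overwrites it with the admissible `l`.
    have hb : ∀ p, 1 ≤ Function.update L r l p ∧ Function.update L r l p ≤ M p := by
      intro p
      rcases eq_or_ne p r with rfl | hp
      · rw [Function.update_self]; omega
      · rw [Function.update_of_ne hp]; exact hL p hp
    rw [mseSS_eq alg (fun p => (hb p).2) (fun p => (hb p).1)
      (by rw [Function.update_self]; omega) μ δ hs hW hNC, aConst_update, Function.update_self,
      modeFactor]
  refine ⟨hno, setOf_isMinOn_modeFactor hMr (mul_pos (one_div_pos.mpr hρ) ha) hss, ?_⟩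
  intro l hl
  obtain ⟨b1, b2⟩ := Lopt_bounds hMr
  have hmem : l ∈ Set.Icc 1 (M r - 1) := by
    rcases hl with rfl | rfl <;> constructor <;> omega
  have hfac : modeFactor (M r) l = modeFactor (M r) (Lopt (M r)) := by
    rcases hl with rfl | rfl
    · rfl
    · exact modeFactor_reflect (by omega)
  rw [hno, hss l hmem, hfac, mul_assoc, mul_div_mul_left _ _ (one_div_pos.mpr hρ).ne']
  exact gainFormula_eq hMr hprod ha.ne'
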